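/- Let $(X,\Sigma)$ be an arbitrary measurable space and let $p(x,E)$, $x\in X$, $E\in\Sigma$, be the transition function of a Markov chain on it: $p(x,\cdot)$ is a (countably additive) probability measure for every $x$, and $p(\cdot,E)$ is measurable for every $E\in\Sigma$. Let $ba(X,\Sigma)$ be the space of bounded finitely additive measures $\mu:\Sigma\to\mathbb R$ with the total variation norm, $ca(X,\Sigma)$ its subspace of countably additive measures, and let $$A\mu(E)=\int_X p(x,E)\,\mu(dx),\qquad \mu\in ba(X,\Sigma),\ E\in\Sigma,$$ be the Markov operator, which maps $ca(X,\Sigma)$ to itself. Put $$\Delta_{ba}=\{\mu\in ba(X,\Sigma):\mu\ge0,\ \|\mu\|=1,\ A\mu=\mu\},\quad \Delta_{ca}=\Delta_{ba}\cap ca(X,\Sigma),\quad M_{ca}=\{\mu\in ca(X,\Sigma):A\mu=\mu\},$$ and let $\dim\Delta$ denote the dimension of the linear span of $\Delta$. **Theorem 4.5.** Assume condition $(*)$: $\Delta_{ba}\subset ca(X,\Sigma)$, i.e. every invariant finitely additive probability measure is countably additive. Then 1. $M_{ca}$ is finite-dimensional, and $\dim M_{ca}=\dim\Delta_{ba}=\dim\Delta_{ca}=n$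 for some integer $0\le n<\infty$; 2. the spectral projection $E(1,A)$ of $A:ca(X,\Sigma)\to ca(X,\Sigma)$ at $\lambda=1$ exists and its range is $M_{ca}$, and $$\frac1m\sum_{i=1}^{m}A^{i}\to E(1,A)\qquad(m\to\infty)$$ in the operator norm on $ca(X,\Sigma)$. Here the spectral projection of a bounded operator $T$ on a Banach space at $\lambda$ is the unique bounded projection $E$ that commutes with $T$ and such that $T-\lambda$ is quasinilpotent on the range of $E$ and maps the kernel of $E$ bijectively onto itself ($E=0$ if $\lambda$ is not in the spectrum of $T$). -/

import Mathlib

open MeasureTheory ProbabilityTheory Filter Topology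

/-- A bounded finitely additive real-valued measure on the `σ`-algebra of `X`, of arbitrary sign.
As for Mathlib's vector measures, it is a function on all subsets, with the value `0` on
non-measurable ones, so that two of them are equal as soon as they agree on measurable sets. -/
structure FinAddMeasure (X : Type*) [MeasurableSpace X] where
  toFun : Set X → ℝ
  not_measurable' : ∀ s, ¬ MeasurableSet s → toFun s = 0
  empty' : toFun ∅ = 0
  union' : ∀ s t, MeasurableSet s → MeasurableSet t → Disjoint s t →
    toFun (s ∪ t) = toFun s + toFun t
  bounded' : ∃ C, ∀ s, |toFun s| ≤ C

namespace FinAddMeasure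

variable {X : Type*} [MeasurableSpace X]

instance : CoeFun (FinAddMeasure X) (fun _ => Set X → ℝ) := ⟨toFun⟩

theorem toFun_injective : Function.Injective (toFun : FinAddMeasure X → Set X → ℝ) := by
  rintro ⟨f, _, _, _, _⟩ ⟨g, _, _, _, _⟩ h
  cases h
  rfl

theorem ext {μ ν : FinAddMeasure X} (h : ∀ s, MeasurableSet s → μ s = ν s) : μ = ν := by
  refine toFun_injective (funext fun s => ?_)
  by_cases hs : MeasurableSet s
  · exact h s hs
  · rw [μ.not_measurable' s hs, ν.not_measurable' s hs]

instance : Zero (FinAddMeasure X) :=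
  ⟨⟨fun _ => 0, fun _ _ => rfl, rfl, fun _ _ _ _ _ => by simp, 0, fun _ => by simp⟩⟩

instance : Add (FinAddMeasure X) :=
  ⟨fun μ ν => ⟨fun s => μ s + ν s,
    fun s hs => by rw [μ.not_measurable' s hs, ν.not_measurable' s hs, add_zero],
    by rw [μ.empty', ν.empty', add_zero],
    fun s t hs ht hst => by rw [μ.union' s t hs ht hst, ν.union' s t hs ht hst]; ring,
    by
      obtain ⟨C, hC⟩ := μ.bounded'
      obtain ⟨D, hD⟩ := ν.bounded'
      exact ⟨C + D, fun s => (abs_add_le _ _).trans (add_le_add (hC s) (hD s))⟩⟩⟩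

instance {R : Type*} [SMul R ℝ] [IsScalarTower R ℝ ℝ] : SMul R (FinAddMeasure X) :=
  ⟨fun c μ => ⟨fun s => c • μ s,
    fun s hs => by rw [μ.not_measurable' s hs, ← smul_one_smul ℝ c (0 : ℝ), smul_zero],
    by rw [μ.empty', ← smul_one_smul ℝ c (0 : ℝ), smul_zero],
    fun s t hs ht hst => by
      rw [μ.union' s t hs ht hst, ← smul_one_smul ℝ c, smul_add, smul_one_smul, smul_one_smul],
    by
      obtain ⟨C, hC⟩ := μ.bounded'
      refine ⟨|c • (1 : ℝ)| * C, fun s => ?_⟩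
      rw [← smul_one_smul ℝ c, smul_eq_mul, abs_mul]
      exact mul_le_mul_of_nonneg_left (hC s) (abs_nonneg _)⟩⟩

instance : Neg (FinAddMeasure X) :=
  ⟨fun μ => ⟨fun s => - μ s,
    fun s hs => by rw [μ.not_measurable' s hs, neg_zero],
    by rw [μ.empty', neg_zero],
    fun s t hs ht hst => by rw [μ.union' s t hs ht hst]; ring,
    by
      obtain ⟨C, hC⟩ := μ.bounded'
      exact ⟨C, fun s => by rw [abs_neg]; exact hC s⟩⟩⟩

instance : Sub (FinAddMeasure X) :=
  ⟨fun μ ν => ⟨fun s => μ s - ν s,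
    fun s hs => by rw [μ.not_measurable' s hs, ν.not_measurable' s hs, sub_zero],
    by rw [μ.empty', ν.empty', sub_zero],
    fun s t hs ht hst => by rw [μ.union' s t hs ht hst, ν.union' s t hs ht hst]; ring,
    by
      obtain ⟨C, hC⟩ := μ.bounded'
      obtain ⟨D, hD⟩ := ν.bounded'
      exact ⟨C + D, fun s => (abs_sub _ _).trans (add_le_add (hC s) (hD s))⟩⟩⟩

instance : AddCommGroup (FinAddMeasure X) :=
  toFun_injective.addCommGroup toFun rfl (fun _ _ => rfl) (fun _ => rfl) (fun _ _ => rfl)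
    (fun _ _ => rfl) (fun _ _ => rfl)

/-- Evaluation on sets, as a homomorphism. -/
def coeFnAddHom : FinAddMeasure X →+ (Set X → ℝ) where
  toFun := toFun
  map_zero' := rfl
  map_add' _ _ := rfl

instance : Module ℝ (FinAddMeasure X) :=
  toFun_injective.module ℝ coeFnAddHom (fun _ _ => rfl)

@[simp] theorem zero_apply (s : Set X) : (0 : FinAddMeasure X) s = 0 := rfl
@[simp] theorem add_apply (μ ν : FinAddMeasure X) (s : Set X) : (μ + ν) s = μ s + ν s := rfl
@[simp] theorem smul_apply (c : ℝ) (μ : FinAddMeasure X) (s : Set X) : (c • μ) s = c * μ s := rfl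

/-- Finite additivity over a finite disjoint family of measurable sets. -/
theorem biUnion (μ : FinAddMeasure X) {ι : Type*} (P : Finset ι) (S : ι → Set X)
    (hS : ∀ i ∈ P, MeasurableSet (S i)) (hd : (P : Set ι).PairwiseDisjoint S) :
    μ (⋃ i ∈ P, S i) = ∑ i ∈ P, μ (S i) := by
  classical
  induction P using Finset.induction_on with
  | empty => simpa using μ.empty'
  | insert a P ha ih =>
    rw [Finset.set_biUnion_insert, Finset.sum_insert ha, μ.union', ih]
    · exact fun i hi => hS i (Finset.mem_insert_of_mem hi)
    · exact hd.subset (by simp)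
    · exact hS a (Finset.mem_insert_self _ _)
    · exact P.measurableSet_biUnion fun i hi => hS i (Finset.mem_insert_of_mem hi)
    · rw [Set.disjoint_iUnion₂_right]
      intro i hi
      exact hd (by simp) (by simp [hi]) (by rintro rfl; exact ha hi)

theorem sum_abs_le (μ : FinAddMeasure X) {C : ℝ} (hC : ∀ s, |μ s| ≤ C) (P : Finset (Set X))
    (hP : ∀ s ∈ P, MeasurableSet s) (hd : (P : Set (Set X)).PairwiseDisjoint id) :
    ∑ s ∈ P, |μ s| ≤ 2 * C := by
  classical
  have key : ∀ Q ⊆ P, |∑ s ∈ Q, μ s| ≤ C := by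
    intro Q hQ
    have := μ.biUnion Q id (fun s hs => hP s (hQ hs)) (hd.subset (by exact_mod_cast hQ))
    simp only [id] at this
    rw [← this]
    exact hC _
  have h1 := key (P.filter fun s => 0 ≤ μ s) (Finset.filter_subset _ _)
  have h2 := key (P.filter fun s => ¬ 0 ≤ μ s) (Finset.filter_subset _ _)
  rw [← Finset.sum_filter_add_sum_filter_not P (fun s => 0 ≤ μ s)]
  have e1 : ∑ s ∈ P.filter (fun s => 0 ≤ μ s), |μ s| = ∑ s ∈ P.filter (fun s => 0 ≤ μ s), μ s :=
    Finset.sum_congr rfl fun s hs => abs_of_nonneg (Finset.mem_filter.1 hs).2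
  have e2 : ∑ s ∈ P.filter (fun s => ¬ 0 ≤ μ s), |μ s|
      = - ∑ s ∈ P.filter (fun s => ¬ 0 ≤ μ s), μ s := by
    rw [← Finset.sum_neg_distrib]
    exact Finset.sum_congr rfl fun s hs => abs_of_neg (not_le.1 (Finset.mem_filter.1 hs).2)
  rw [e1, e2]
  have := abs_le.1 h1
  have := abs_le.1 h2
  linarith

/-- The sums `∑ |μ(E)|` over finite families of pairwise disjoint measurable sets `E`. -/
def variationSums (μ : FinAddMeasure X) : Set ℝ :=
  {r | ∃ P : Finset (Set X), (∀ s ∈ P, MeasurableSet s) ∧ (P : Set (Set X)).PairwiseDisjoint id ∧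
    r = ∑ s ∈ P, |μ s|}

/-- The norm of a finitely additive measure is its total variation. -/
noncomputable instance : Norm (FinAddMeasure X) := ⟨fun μ => sSup μ.variationSums⟩

theorem norm_def (μ : FinAddMeasure X) : ‖μ‖ = sSup μ.variationSums := rfl

theorem variationSums_nonempty (μ : FinAddMeasure X) : μ.variationSums.Nonempty :=
  ⟨0, ∅, by simp⟩

theorem bddAbove_variationSums (μ : FinAddMeasure X) : BddAbove μ.variationSums := by
  obtain ⟨C, hC⟩ := μ.bounded'
  refine ⟨2 * C, ?_⟩
  rintro r ⟨P, hP, hd, rfl⟩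
  exact μ.sum_abs_le hC P hP hd

theorem sum_abs_le_norm (μ : FinAddMeasure X) (P : Finset (Set X))
    (hP : ∀ s ∈ P, MeasurableSet s) (hd : (P : Set (Set X)).PairwiseDisjoint id) :
    ∑ s ∈ P, |μ s| ≤ ‖μ‖ :=
  le_csSup μ.bddAbove_variationSums ⟨P, hP, hd, rfl⟩

theorem norm_le (μ : FinAddMeasure X) {C : ℝ}
    (h : ∀ P : Finset (Set X), (∀ s ∈ P, MeasurableSet s) →
      (P : Set (Set X)).PairwiseDisjoint id → ∑ s ∈ P, |μ s| ≤ C) : ‖μ‖ ≤ C := by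
  refine csSup_le μ.variationSums_nonempty ?_
  rintro r ⟨P, hP, hd, rfl⟩
  exact h P hP hd

theorem norm_nonneg' (μ : FinAddMeasure X) : 0 ≤ ‖μ‖ := by
  simpa using μ.sum_abs_le_norm ∅ (by simp) (by simp)

theorem abs_apply_le_norm (μ : FinAddMeasure X) (s : Set X) : |μ s| ≤ ‖μ‖ := by
  by_cases hs : MeasurableSet s
  · simpa using μ.sum_abs_le_norm {s} (by simpa using hs) (by simp)
  · rw [μ.not_measurable' s hs, abs_zero]
    exact μ.norm_nonneg'

theorem normCore : NormedSpace.Core ℝ (FinAddMeasure X) where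
  norm_nonneg := norm_nonneg'
  norm_smul c μ := by
    have le : ∀ (c : ℝ) (μ : FinAddMeasure X), ‖c • μ‖ ≤ ‖c‖ * ‖μ‖ := by
      intro c μ
      refine norm_le _ fun P hP hd => ?_
      simp only [smul_apply, abs_mul, ← Finset.mul_sum]
      exact mul_le_mul_of_nonneg_left (μ.sum_abs_le_norm P hP hd) (abs_nonneg _)
    refine le_antisymm (le c μ) ?_
    by_cases hc : c = 0
    · subst hc
      rw [norm_zero, zero_mul]
      exact norm_nonneg' _
    · have := le c⁻¹ (c • μ)
      rw [smul_smul, inv_mul_cancel₀ hc, one_smul, norm_inv] at this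
      have hc' : 0 < ‖c‖ := norm_pos_iff.2 hc
      calc ‖c‖ * ‖μ‖ ≤ ‖c‖ * (‖c‖⁻¹ * ‖c • μ‖) := mul_le_mul_of_nonneg_left this hc'.le
        _ = ‖c • μ‖ := by rw [← mul_assoc, mul_inv_cancel₀ hc'.ne', one_mul]
  norm_triangle μ ν := by
    refine norm_le _ fun P hP hd => ?_
    calc ∑ s ∈ P, |(μ + ν) s| ≤ ∑ s ∈ P, (|μ s| + |ν s|) :=
          Finset.sum_le_sum fun s _ => abs_add_le _ _
      _ ≤ ‖μ‖ + ‖ν‖ := by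
          rw [Finset.sum_add_distrib]
          exact add_le_add (μ.sum_abs_le_norm P hP hd) (ν.sum_abs_le_norm P hP hd)
  norm_eq_zero_iff μ := by
    refine ⟨fun h => ext fun s _ => ?_, ?_⟩
    · have := μ.abs_apply_le_norm s
      rw [h] at this
      exact abs_eq_zero.1 (le_antisymm this (abs_nonneg _))
    · rintro rfl
      refine le_antisymm (norm_le _ fun P _ _ => by simp) (norm_nonneg' _)

/-- The normed space `ba(X, Σ)`. -/
noncomputable instance : NormedAddCommGroup (FinAddMeasure X) := NormedAddCommGroup.ofCore normCore

noncomputable instance : NormedSpace ℝ (FinAddMeasure X) := NormedSpace.ofCore normCore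

/-- The subspace `ca(X, Σ)` of countably additive measures; it carries the total variation norm. -/
def ca (X : Type*) [MeasurableSpace X] : Submodule ℝ (FinAddMeasure X) where
  carrier := {μ | ∀ S : ℕ → Set X, (∀ i, MeasurableSet (S i)) →
    Pairwise (Function.onFun Disjoint S) → HasSum (fun i => μ (S i)) (μ (⋃ i, S i))}
  zero_mem' := fun _ _ _ => hasSum_zero
  add_mem' := fun hμ hν S hS hd => (hμ S hS hd).add (hν S hS hd)
  smul_mem' := fun c _ hμ S hS hd => (hμ S hS hd).mul_left c

/-! ### The integral of a bounded measurable function -/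

/-- The integral of a simple function. -/
noncomputable def simpleIntegral (μ : FinAddMeasure X) (s : SimpleFunc X ℝ) : ℝ :=
  ∑ c ∈ s.range, c * μ (s ⁻¹' {c})

/-- The filter on simple functions that describes uniform convergence to `f`. -/
def uniformApprox (f : X → ℝ) : Filter (SimpleFunc X ℝ) :=
  ⨅ r ∈ Set.Ioi (0 : ℝ), 𝓟 {s | ∀ x, |f x - s x| ≤ r}

/-- The integral of a bounded measurable function `f` against a finitely additive measure: the
limit of the integrals of simple functions that converge to `f` uniformly. -/
noncomputable def integral (μ : FinAddMeasure X) (f : X → ℝ) : ℝ :=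
  limUnder (uniformApprox f) μ.simpleIntegral

theorem hasBasis_uniformApprox (f : X → ℝ) :
    (uniformApprox f).HasBasis (fun r : ℝ => 0 < r) (fun r => {s | ∀ x, |f x - s x| ≤ r}) := by
  refine hasBasis_biInf_principal' ?_ ⟨1, Set.mem_Ioi.2 one_pos⟩
  intro r hr r' hr'
  exact ⟨min r r', Set.mem_Ioi.2 (lt_min hr hr'), fun s hs x => (hs x).trans (min_le_left _ _),
    fun s hs x => (hs x).trans (min_le_right _ _)⟩

theorem uniformApprox_neBot {f : X → ℝ} (hf : Measurable f) {C : ℝ} (hC : ∀ x, |f x| ≤ C) :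
    (uniformApprox f).NeBot := by
  rw [(hasBasis_uniformApprox f).neBot_iff]
  intro r hr
  let g : X → ℤ := fun x => ⌊f x / r⌋
  have hg : Measurable g := Int.measurable_floor.comp (hf.div_const r)
  have hfin : (Set.range g).Finite := by
    refine (Set.finite_Icc ⌊-(C / r)⌋ ⌊C / r⌋).subset ?_
    rintro _ ⟨x, rfl⟩
    obtain ⟨h1, h2⟩ := abs_le.1 (hC x)
    refine ⟨Int.floor_le_floor ?_, Int.floor_le_floor ?_⟩
    · rw [← neg_div]; gcongr
    · gcongr
  let s : SimpleFunc X ℤ := ⟨g, fun k => hg (measurableSet_singleton k), hfin⟩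
  refine ⟨s.map (fun k : ℤ => r * k), fun x => ?_⟩
  have e : (s.map (fun k : ℤ => r * k)) x = r * (⌊f x / r⌋ : ℝ) := rfl
  rw [e]
  have h1 := Int.floor_le (f x / r)
  have h2 := Int.lt_floor_add_one (f x / r)
  have e : f x = r * (f x / r) := by field_simp
  rw [abs_le]
  constructor <;> nlinarith

theorem simpleIntegral_eq (μ : FinAddMeasure X) (s : SimpleFunc X ℝ) :
    μ.simpleIntegral s = s.setToSimpleFunc fun t => (μ t) • ContinuousLinearMap.id ℝ ℝ := by
  simp [simpleIntegral, SimpleFunc.setToSimpleFunc, mul_comm]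

theorem finMeasAdditive (μ : FinAddMeasure X) :
    FinMeasAdditive (0 : Measure X) (fun t => (μ t) • ContinuousLinearMap.id ℝ ℝ) := by
  intro s t hs ht _ _ hst
  simp only [μ.union' s t hs ht hst, add_smul]

theorem simpleIntegral_add (μ : FinAddMeasure X) (s t : SimpleFunc X ℝ) :
    μ.simpleIntegral (s + t) = μ.simpleIntegral s + μ.simpleIntegral t := by
  simp only [simpleIntegral_eq]
  exact SimpleFunc.setToSimpleFunc_add _ μ.finMeasAdditive (by simp) (by simp)

theorem simpleIntegral_sub (μ : FinAddMeasure X) (s t : SimpleFunc X ℝ) :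
    μ.simpleIntegral (s - t) = μ.simpleIntegral s - μ.simpleIntegral t := by
  simp only [simpleIntegral_eq]
  exact SimpleFunc.setToSimpleFunc_sub _ μ.finMeasAdditive (by simp) (by simp)

theorem abs_simpleIntegral_le (μ : FinAddMeasure X) (s : SimpleFunc X ℝ) {C : ℝ}
    (hC : ∀ x, |s x| ≤ C) : |μ.simpleIntegral s| ≤ C * ‖μ‖ := by
  classical
  rcases isEmpty_or_nonempty X with hX | ⟨⟨x₀⟩⟩
  · have h0 : ‖μ‖ = 0 := by
      have : μ = 0 := ext fun t _ => by rw [Set.eq_empty_of_isEmpty t, μ.empty', zero_apply]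
      rw [this, norm_zero]
    rw [h0, mul_zero, simpleIntegral, SimpleFunc.range_eq_empty_of_isEmpty]
    simp
  have hC0 : 0 ≤ C := (abs_nonneg _).trans (hC x₀)
  have hinj : Set.InjOn (fun c : ℝ => s ⁻¹' {c}) (s.range : Set ℝ) := by
    intro c hc d _ h
    obtain ⟨x, rfl⟩ := SimpleFunc.mem_range.1 hc
    have : x ∈ s ⁻¹' {d} := by
      rw [← show s ⁻¹' {s x} = s ⁻¹' {d} from h]
      simp
    simpa using this
  have hsum : ∑ c ∈ s.range, |μ (s ⁻¹' {c})| ≤ ‖μ‖ := by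
    have := μ.sum_abs_le_norm (s.range.image fun c => s ⁻¹' {c})
      (by
        intro t ht
        obtain ⟨c, _, rfl⟩ := Finset.mem_image.1 ht
        exact s.measurableSet_fiber c)
      (by
        intro t ht u hu htu
        obtain ⟨c, _, rfl⟩ := Finset.mem_image.1 ht
        obtain ⟨d, _, rfl⟩ := Finset.mem_image.1 hu
        have : c ≠ d := by
          rintro rfl
          exact htu rfl
        exact Disjoint.preimage _ (by simpa using this))
    rwa [Finset.sum_image hinj] at this
  calc |μ.simpleIntegral s| ≤ ∑ c ∈ s.range, |c * μ (s ⁻¹' {c})| :=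
        Finset.abs_sum_le_sum_abs _ _
    _ ≤ ∑ c ∈ s.range, C * |μ (s ⁻¹' {c})| := by
        refine Finset.sum_le_sum fun c hc => ?_
        obtain ⟨x, rfl⟩ := SimpleFunc.mem_range.1 hc
        rw [abs_mul]
        exact mul_le_mul_of_nonneg_right (hC x) (abs_nonneg _)
    _ ≤ C * ‖μ‖ := by
        rw [← Finset.mul_sum]
        exact mul_le_mul_of_nonneg_left hsum hC0

/-- The integral of a bounded measurable function is a genuine limit. -/
theorem tendsto_integral (μ : FinAddMeasure X) {f : X → ℝ} (hf : Measurable f) {C : ℝ}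
    (hC : ∀ x, |f x| ≤ C) :
    Tendsto μ.simpleIntegral (uniformApprox f) (𝓝 (μ.integral f)) := by
  have := uniformApprox_neBot hf hC
  refine tendsto_nhds_limUnder ?_
  suffices Cauchy (map μ.simpleIntegral (uniformApprox f)) from CompleteSpace.complete this
  rw [Metric.cauchy_iff]
  refine ⟨inferInstance, fun ε hε => ?_⟩
  have hpos : 0 < ‖μ‖ + 1 := add_pos_of_nonneg_of_pos (norm_nonneg _) one_pos
  have hr : 0 < ε / (2 * (‖μ‖ + 1)) := by positivity
  refine ⟨_, image_mem_map ((hasBasis_uniformApprox f).mem_of_mem hr), ?_⟩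
  rintro _ ⟨s, hs, rfl⟩ _ ⟨t, ht, rfl⟩
  rw [Real.dist_eq, ← simpleIntegral_sub]
  refine (μ.abs_simpleIntegral_le (s - t) (C := 2 * (ε / (2 * (‖μ‖ + 1)))) fun x => ?_).trans_lt ?_
  · have h1 := abs_le.1 (hs x)
    have h2 := abs_le.1 (ht x)
    rw [SimpleFunc.coe_sub, Pi.sub_apply, abs_le]
    constructor <;> linarith
  · have : 2 * (ε / (2 * (‖μ‖ + 1))) * ‖μ‖ = ε * (‖μ‖ / (‖μ‖ + 1)) := by field_simp
    rw [this]
    have h1 : ‖μ‖ / (‖μ‖ + 1) < 1 := by rw [div_lt_one hpos]; linarith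
    nlinarith

theorem integral_add_left (μ ν : FinAddMeasure X) {f : X → ℝ} (hf : Measurable f) {C : ℝ}
    (hC : ∀ x, |f x| ≤ C) : (μ + ν).integral f = μ.integral f + ν.integral f := by
  have := uniformApprox_neBot hf hC
  refine tendsto_nhds_unique ((μ + ν).tendsto_integral hf hC)
    (((μ.tendsto_integral hf hC).add (ν.tendsto_integral hf hC)).congr fun s => ?_)
  simp [simpleIntegral, mul_add, Finset.sum_add_distrib]

theorem integral_smul_left (c : ℝ) (μ : FinAddMeasure X) {f : X → ℝ} (hf : Measurable f) {C : ℝ}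
    (hC : ∀ x, |f x| ≤ C) : (c • μ).integral f = c * μ.integral f := by
  have := uniformApprox_neBot hf hC
  refine tendsto_nhds_unique ((c • μ).tendsto_integral hf hC)
    (((μ.tendsto_integral hf hC).const_mul c).congr fun s => ?_)
  simp only [simpleIntegral, smul_apply, Finset.mul_sum]
  exact Finset.sum_congr rfl fun _ _ => by ring

theorem integral_add_right (μ : FinAddMeasure X) {f g : X → ℝ} (hf : Measurable f)
    (hg : Measurable g) {C D : ℝ} (hC : ∀ x, |f x| ≤ C) (hD : ∀ x, |g x| ≤ D) :
    μ.integral (fun x => f x + g x) = μ.integral f + μ.integral g := by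
  have := uniformApprox_neBot hf hC
  have := uniformApprox_neBot hg hD
  have hfg : Tendsto (fun p : SimpleFunc X ℝ × SimpleFunc X ℝ => p.1 + p.2)
      (uniformApprox f ×ˢ uniformApprox g) (uniformApprox fun x => f x + g x) := by
    rw [((hasBasis_uniformApprox f).prod (hasBasis_uniformApprox g)).tendsto_iff
      (hasBasis_uniformApprox _)]
    intro r hr
    refine ⟨(r / 2, r / 2), ⟨by positivity, by positivity⟩, ?_⟩
    rintro ⟨s, t⟩ ⟨hs, ht⟩ x
    have h1 := abs_le.1 (hs x)
    have h2 := abs_le.1 (ht x)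
    simp only at h1 h2 ⊢
    rw [SimpleFunc.coe_add, Pi.add_apply, abs_le]
    constructor <;> linarith
  refine tendsto_nhds_unique ((μ.tendsto_integral (hf.add hg) (C := C + D)
    (fun x => (abs_add_le _ _).trans (add_le_add (hC x) (hD x)))).comp hfg)
    ((((μ.tendsto_integral hf hC).comp tendsto_fst).add
      ((μ.tendsto_integral hg hD).comp tendsto_snd)).congr fun p => ?_)
  exact (μ.simpleIntegral_add p.1 p.2).symm

theorem abs_integral_le (μ : FinAddMeasure X) {f : X → ℝ} (hf : Measurable f) {C : ℝ}
    (hC : ∀ x, |f x| ≤ C) : |μ.integral f| ≤ C * ‖μ‖ := by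
  have := uniformApprox_neBot hf hC
  refine le_of_forall_pos_le_add fun ε hε => ?_
  have hpos : 0 < ‖μ‖ + 1 := add_pos_of_nonneg_of_pos (norm_nonneg _) one_pos
  have hr : 0 < ε / (‖μ‖ + 1) := by positivity
  refine le_of_tendsto (μ.tendsto_integral hf hC).abs ?_
  filter_upwards [(hasBasis_uniformApprox f).mem_of_mem hr] with s hs
  refine (μ.abs_simpleIntegral_le s (C := C + ε / (‖μ‖ + 1)) fun x => ?_).trans ?_
  · have h1 := abs_le.1 (hs x)
    have h2 := abs_le.1 (hC x)
    rw [abs_le]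
    constructor <;> linarith
  · rw [add_mul]
    have : ε / (‖μ‖ + 1) * ‖μ‖ ≤ ε := by
      rw [div_mul_eq_mul_div, div_le_iff₀ hpos]
      nlinarith
    linarith

/-- A countably additive measure, as a signed measure of Mathlib. -/
def toSignedMeasure (μ : FinAddMeasure X) (hμ : μ ∈ ca X) : SignedMeasure X where
  measureOf' := μ
  empty' := μ.empty'
  not_measurable' s hs := μ.not_measurable' s hs
  m_iUnion' S hS hd := hμ S hS hd

/-- On countably additive measures, the integral is the Lebesgue integral. -/
theorem integral_eq_of_mem_ca (μ : FinAddMeasure X) (hμ : μ ∈ ca X) {f : X → ℝ}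
    (hf : Measurable f) {C : ℝ} (hC : ∀ x, |f x| ≤ C) :
    μ.integral f = (∫ x, f x ∂(μ.toSignedMeasure hμ).toJordanDecomposition.posPart)
      - ∫ x, f x ∂(μ.toSignedMeasure hμ).toJordanDecomposition.negPart := by
  have := uniformApprox_neBot hf hC
  set j := (μ.toSignedMeasure hμ).toJordanDecomposition with hj
  have hint : ∀ (ν : Measure X) [IsFiniteMeasure ν],
      Tendsto (fun s : SimpleFunc X ℝ => ∫ x, s x ∂ν) (uniformApprox f) (𝓝 (∫ x, f x ∂ν)) := by
    intro ν _
    have hfi : Integrable f ν :=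
      Integrable.of_bound hf.aestronglyMeasurable C (Eventually.of_forall hC)
    rw [(hasBasis_uniformApprox f).tendsto_iff Metric.nhds_basis_closedBall]
    intro ε hε
    have hpos : 0 < ν.real Set.univ + 1 := add_pos_of_nonneg_of_pos measureReal_nonneg one_pos
    refine ⟨ε / (ν.real Set.univ + 1), by positivity, fun s hs => ?_⟩
    have hsi : Integrable s ν := SimpleFunc.integrable_of_isFiniteMeasure s
    rw [mem_closedBall_iff_norm', ← integral_sub hfi hsi]
    refine (norm_integral_le_of_norm_le_const (C := ε / (ν.real Set.univ + 1))
      (Eventually.of_forall fun x => hs x)).trans ?_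
    rw [div_mul_eq_mul_div, div_le_iff₀ hpos]
    nlinarith
  refine tendsto_nhds_unique (μ.tendsto_integral hf hC)
    (((hint j.posPart).sub (hint j.negPart)).congr fun s => ?_)
  rw [SimpleFunc.integral_eq_sum _ (SimpleFunc.integrable_of_isFiniteMeasure s),
    SimpleFunc.integral_eq_sum _ (SimpleFunc.integrable_of_isFiniteMeasure s),
    ← Finset.sum_sub_distrib, simpleIntegral]
  refine Finset.sum_congr rfl fun c _ => ?_
  have h := SignedMeasure.apply_eq_posPart_real_sub_negPart_real (μ.toSignedMeasure hμ)
    (s.measurableSet_fiber c)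
  have h' : μ.toSignedMeasure hμ (s ⁻¹' {c}) = μ (s ⁻¹' {c}) := rfl
  rw [h'] at h
  rw [h, smul_eq_mul, smul_eq_mul]
  ring

end FinAddMeasure

/-! ### The Markov operator -/

section Markov

open FinAddMeasure

variable {X : Type*} [MeasurableSpace X] (p : Kernel X X)

theorem measurable_transition {E : Set X} (hE : MeasurableSet E) :
    Measurable fun x => (p x).real E :=
  (p.measurable_coe hE).ennreal_toReal

variable [IsMarkovKernel p]

theorem abs_transition_le (E : Set X) (x : X) : |(p x).real E| ≤ 1 := by
  rw [abs_of_nonneg measureReal_nonneg]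
  exact measureReal_le_one

open Classical in
/-- The measure `A μ`, given by `A μ (E) = ∫ p(x, E) μ(dx)` for measurable `E`. -/
noncomputable def markovFun (μ : FinAddMeasure X) : FinAddMeasure X where
  toFun E := if MeasurableSet E then μ.integral (fun x => (p x).real E) else 0
  not_measurable' E hE := if_neg hE
  empty' := by
    rw [if_pos MeasurableSet.empty]
    have h := μ.abs_integral_le (f := fun x => (p x).real ∅)
      (measurable_transition p MeasurableSet.empty) (C := 0) (by simp)
    rw [zero_mul] at h
    exact abs_eq_zero.1 (le_antisymm h (abs_nonneg _))
  union' s t hs ht hst := by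
    rw [if_pos hs, if_pos ht, if_pos (hs.union ht),
      ← μ.integral_add_right (measurable_transition p hs) (measurable_transition p ht)
        (abs_transition_le p s) (abs_transition_le p t)]
    congr 1
    funext x
    exact measureReal_union hst ht
  bounded' := by
    refine ⟨‖μ‖, fun s => ?_⟩
    split_ifs with hs
    · simpa using μ.abs_integral_le (measurable_transition p hs) (abs_transition_le p s)
    · simp

theorem markovFun_apply (μ : FinAddMeasure X) {E : Set X} (hE : MeasurableSet E) :
    markovFun p μ E = μ.integral fun x => (p x).real E := if_pos hE

/-- The Markov operator `A : ba(X, Σ) → ba(X, Σ)` of the chain with transition function `p`. -/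
noncomputable def markovBA : FinAddMeasure X →L[ℝ] FinAddMeasure X :=
  LinearMap.mkContinuous
    { toFun := markovFun p
      map_add' := fun μ ν => FinAddMeasure.ext fun E hE => by
        rw [FinAddMeasure.add_apply]
        simp only [markovFun_apply p _ hE]
        exact integral_add_left μ ν (measurable_transition p hE) (abs_transition_le p E)
      map_smul' := fun c μ => FinAddMeasure.ext fun E hE => by
        rw [RingHom.id_apply, FinAddMeasure.smul_apply]
        simp only [markovFun_apply p _ hE]
        exact integral_smul_left c μ (measurable_transition p hE) (abs_transition_le p E) }
    2
    (fun μ => norm_le _ fun P hP hd => sum_abs_le _ (fun s => by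
      by_cases hs : MeasurableSet s
      · have := μ.abs_integral_le (measurable_transition p hs) (abs_transition_le p s)
        rw [one_mul] at this
        change |markovFun p μ s| ≤ ‖μ‖
        rwa [markovFun_apply p μ hs]
      · rw [FinAddMeasure.not_measurable' _ s hs, abs_zero]
        exact norm_nonneg μ) P hP hd)

theorem markovBA_apply (μ : FinAddMeasure X) {E : Set X} (hE : MeasurableSet E) :
    markovBA p μ E = μ.integral fun x => (p x).real E := markovFun_apply p μ hE

/-- The Markov operator maps countably additive measures to countably additive measures. -/
theorem markovBA_mem_ca {μ : FinAddMeasure X} (hμ : μ ∈ ca X) : markovBA p μ ∈ ca X := by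
  set j := (μ.toSignedMeasure hμ).toJordanDecomposition with hj
  have hb : ∀ (ν : Measure X) [IsFiniteMeasure ν] (E : Set X), MeasurableSet E →
      ∫ x, (p x).real E ∂ν = (p ∘ₘ ν).real E := by
    intro ν _ E hE
    rw [measureReal_def, Measure.bind_apply hE p.aemeasurable]
    exact integral_toReal (p.measurable_coe hE).aemeasurable
      (Eventually.of_forall fun x => measure_lt_top _ _)
  have key : ∀ E, MeasurableSet E → markovBA p μ E =
      ((p ∘ₘ j.posPart).toSignedMeasure - (p ∘ₘ j.negPart).toSignedMeasure) E := by
    intro E hE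
    rw [markovBA_apply p μ hE, μ.integral_eq_of_mem_ca hμ (measurable_transition p hE)
      (abs_transition_le p E), hb _ E hE, hb _ E hE, _root_.sub_apply,
      Measure.toSignedMeasure_apply_measurable hE, Measure.toSignedMeasure_apply_measurable hE]
  intro S hS hd
  have h := VectorMeasure.m_iUnion
    ((p ∘ₘ j.posPart).toSignedMeasure - (p ∘ₘ j.negPart).toSignedMeasure) hS hd
  rw [← key _ (MeasurableSet.iUnion hS)] at h
  exact h.congr_fun fun i => (key _ (hS i))

/-- The Markov operator `A : ca(X, Σ) → ca(X, Σ)`, the restriction of `markovBA`. -/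
noncomputable def markovCA : ca X →L[ℝ] ca X :=
  ((markovBA p).comp (ca X).subtypeL).codRestrict (ca X) fun μ => markovBA_mem_ca p μ.2

/-- The set `Δ_ba` of invariant finitely additive probability measures. -/
def invProbBA : Set (FinAddMeasure X) :=
  {μ | (∀ E, 0 ≤ μ E) ∧ ‖μ‖ = 1 ∧ markovBA p μ = μ}

/-- The set `Δ_ca` of invariant countably additive probability measures. -/
def invProbCA : Set (FinAddMeasure X) :=
  {μ | μ ∈ ca X ∧ (∀ E, 0 ≤ μ E) ∧ ‖μ‖ = 1 ∧ markovBA p μ = μ}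

/-- The subspace `M_ca` of all invariant measures in `ca(X, Σ)`. -/
noncomputable def invCA : Submodule ℝ (ca X) where
  carrier := {μ | markovCA p μ = μ}
  zero_mem' := map_zero _
  add_mem' := fun {μ ν} hμ hν => by
    change markovCA p (μ + ν) = μ + ν
    rw [map_add, show markovCA p μ = μ from hμ, show markovCA p ν = ν from hν]
  smul_mem' := fun c μ hμ => by
    change markovCA p (c • μ) = c • μ
    rw [map_smul, show markovCA p μ = μ from hμ]

end Markov

/-- `E` is the spectral projection `E(lam, T)` of the bounded operator `T` at the point `lam`: it is
the (unique) bounded projection that commutes with `T` and splits the space into its range, on which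
`T - lam` is quasinilpotent, and its kernel, on which `T - lam` is invertible. It is `0` when `lam`
is not in the spectrum. -/
structure IsSpectralProjection {V : Type*} [NormedAddCommGroup V] [NormedSpace ℝ V]
    (T : V →L[ℝ] V) (lam : ℝ) (E : V →L[ℝ] V) : Prop where
  idempotent : E * E = E
  commute : E * T = T * E
  quasinilpotent : Tendsto (fun n : ℕ => ‖((T - lam • 1) * E) ^ n‖ ^ (1 / (n : ℝ))) atTop (𝓝 0)
  bijOn_ker : Set.BijOn (fun v => T v - lam • v) {v | E v = 0} {v | E v = 0}

/-! The idea is that the hypothesis on invariant means forces a Doeblin condition, and that this condition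
makes the averages of the chain converge in norm.

Write `A` for the Markov operator on `ca` and `A_m = (A + ⋯ + A^m) / m`. A limit along an ultrafilter
of averages `A_m ν_m` of probability measures is an invariant finitely additive probability, so by
hypothesis it is countably additive (`exists_invariant_limit`). This is used twice.
* There is no infinite sequence of mutually singular invariant probabilities, since a limit of it would
  not be continuous along a decreasing sequence of sets. So a finite sum `σ` of invariant probabilities
  dominates all of them (`exists_dominating_invariant`).
* The averages `A_m ν` are uniformly absolutely continuous with respect to `σ`, as `m → ∞`
  (`exists_uniform_absolutelyContinuous`).

Finite dimension. By the second point, no invariant probability is concentrated on a set of small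
`σ`-measure; applied to the positive part of `μ - c σ` this gives `μ ≤ c σ` for all invariant
probabilities `μ`, with one constant `c`. So the invariant measures form a subspace of `L²(σ)` on which
the supremum norm is bounded by the `L²` norm, and such a subspace has finite dimension
(`finiteDimensional_of_ae_abs_le`).

Strong convergence. On densities in `L²(σ)`, `A` is a contraction of a Hilbert space, and von Neumann's
mean ergodic theorem applies. By density the averages of every `ν ≪ σ` converge in total variation, and
so do those of every `ν`, because the parts of `A_m ν` that are singular to `σ` vanish in the limit
(`tendsto_cesaro_markovCA`). Call the limit operator `E`.

Norm convergence. Let `S_m = A_m - E`, so that `S_m² = S_m A_m`. For sets `D_m`, the functions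
`x ↦ (S_m δ_x)(D_m)` tend to zero at every point, hence in `σ`-measure; by uniform absolute continuity
`A_m ν` has little mass where they are not small. So `(S_m² ν)(D_m)`, the integral of this function
against `A_m ν`, is small uniformly in `ν` (`exists_norm_mul_self_lt_one`). This is the argument that on a
Grothendieck space with the Dunford-Pettis property strongly ergodic operators are uniformly ergodic.
Once `‖S_m²‖ < 1` for one `m`, a Neumann series inverts `1 - A` on the kernel of `E`, and both the
spectral projection and the convergence in norm follow (`isSpectralProjection_of_norm_lt_one`). -/

/-! ### The Banach spaces of finitely and of countably additive measures -/

namespace FinAddMeasure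

variable {X : Type*} [MeasurableSpace X]

theorem sub_apply (μ ν : FinAddMeasure X) (s : Set X) : (μ - ν) s = μ s - ν s := rfl

theorem norm_le_two_mul (μ : FinAddMeasure X) {C : ℝ} (hC : 0 ≤ C)
    (h : ∀ s, MeasurableSet s → |μ s| ≤ C) : ‖μ‖ ≤ 2 * C :=
  norm_le _ fun P hP hd => sum_abs_le _ (fun s => by
    by_cases hs : MeasurableSet s
    · exact h s hs
    · rw [μ.not_measurable' s hs, abs_zero]
      exact hC) P hP hd

theorem norm_eq_of_nonneg (μ : FinAddMeasure X) (h : ∀ s, 0 ≤ μ s) : ‖μ‖ = μ Set.univ := by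
  refine le_antisymm (norm_le _ fun P hP hd => ?_) ((le_abs_self _).trans (abs_apply_le_norm _ _))
  have h1 := μ.biUnion P id hP hd
  have hm : MeasurableSet (⋃ i ∈ P, id i) := P.measurableSet_biUnion hP
  have h2 := μ.union' _ _ hm hm.compl disjoint_compl_right
  rw [Set.union_compl_self] at h2
  have h3 := h (⋃ i ∈ P, id i)ᶜ
  calc ∑ s ∈ P, |μ s| = ∑ s ∈ P, μ (id s) :=
        Finset.sum_congr rfl fun s _ => abs_of_nonneg (h s)
    _ ≤ μ Set.univ := by rw [← h1]; linarith

instance : CompleteSpace (FinAddMeasure X) := by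
  refine Metric.complete_of_cauchySeq_tendsto fun u hu => ?_
  have hc : ∀ s, CauchySeq fun n => u n s := fun s => by
    rw [Metric.cauchySeq_iff] at hu ⊢
    intro ε hε
    obtain ⟨N, hN⟩ := hu ε hε
    refine ⟨N, fun m hm n hn => (lt_of_le_of_lt ?_ (hN m hm n hn))⟩
    rw [Real.dist_eq, dist_eq_norm, ← sub_apply]
    exact abs_apply_le_norm _ _
  choose L hL using fun s => cauchySeq_tendsto_of_complete (hc s)
  obtain ⟨C, hC⟩ := hu.isBounded_range.exists_norm_le
  have hC' : ∀ n, ‖u n‖ ≤ C := fun n => hC _ ⟨n, rfl⟩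
  let l : FinAddMeasure X :=
    { toFun := L
      not_measurable' := fun s hs => tendsto_nhds_unique (hL s) (by
        simp only [(u _).not_measurable' s hs]
        exact tendsto_const_nhds)
      empty' := tendsto_nhds_unique (hL ∅) (by
        simp only [(u _).empty']
        exact tendsto_const_nhds)
      union' := fun s t hs ht hst => tendsto_nhds_unique (hL (s ∪ t)) (by
        simp only [(u _).union' s t hs ht hst]
        exact (hL s).add (hL t))
      bounded' := ⟨C, fun s => le_of_tendsto (hL s).abs
        (Eventually.of_forall fun n => ((u n).abs_apply_le_norm s).trans (hC' n))⟩ }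
  refine ⟨l, ?_⟩
  rw [Metric.tendsto_atTop]
  intro ε hε
  obtain ⟨N, hN⟩ := Metric.cauchySeq_iff.1 hu (ε / 3) (by positivity)
  refine ⟨N, fun n hn => ?_⟩
  rw [dist_eq_norm]
  refine lt_of_le_of_lt (norm_le_two_mul _ (C := ε / 3) (by positivity) fun s _ => ?_)
    (by linarith)
  have h1 : Tendsto (fun m => |u n s - u m s|) atTop (𝓝 |u n s - L s|) :=
    ((hL s).const_sub _).abs
  refine le_of_tendsto h1 ?_
  filter_upwards [eventually_ge_atTop N] with m hm
  have h2 := hN n hn m hm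
  rw [dist_eq_norm] at h2
  exact ((u n - u m).abs_apply_le_norm s).trans h2.le

/-- The defect of countable additivity along `S` is a uniform limit of such defects. -/
theorem isClosed_ca : IsClosed (ca X : Set (FinAddMeasure X)) := by
  rw [← isSeqClosed_iff_isClosed]
  intro u l hu hl S hS hd
  have hfin : ∀ (μ : FinAddMeasure X) (F : Finset ℕ),
      μ (⋃ i, S i) - ∑ i ∈ F, μ (S i) = μ ((⋃ i, S i) \ ⋃ i ∈ F, S i) := by
    intro μ F
    have hm : MeasurableSet (⋃ i ∈ F, S i) := F.measurableSet_biUnion fun i _ => hS i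
    have hsub : (⋃ i ∈ F, S i) ⊆ ⋃ i, S i :=
      Set.iUnion₂_subset fun i _ => Set.subset_iUnion S i
    have h1 := μ.union' _ _ hm ((MeasurableSet.iUnion hS).diff hm) Set.disjoint_sdiff_right
    rw [Set.union_sdiff_cancel hsub,
      μ.biUnion F S (fun i _ => hS i) (fun i _ j _ hij => hd hij)] at h1
    linarith
  have key : Tendsto (fun F : Finset ℕ => l (⋃ i, S i) - ∑ i ∈ F, l (S i)) atTop (𝓝 0) := by
    rw [Metric.tendsto_nhds]
    intro ε hε
    obtain ⟨n, hn⟩ := ((Metric.tendsto_nhds.1 hl) (ε / 2) (by positivity)).exists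
    have hun : Tendsto (fun F : Finset ℕ => u n (⋃ i, S i) - ∑ i ∈ F, u n (S i)) atTop (𝓝 0) := by
      have := (hu n S hS hd).const_sub (u n (⋃ i, S i))
      rwa [sub_self] at this
    filter_upwards [Metric.tendsto_nhds.1 hun (ε / 2) (by positivity)] with F hF
    rw [dist_zero_right, Real.norm_eq_abs, hfin] at hF ⊢
    have h2 := (u n - l).abs_apply_le_norm ((⋃ i, S i) \ ⋃ i ∈ F, S i)
    rw [dist_eq_norm] at hn
    rw [sub_apply] at h2
    rw [abs_le] at h2
    rw [abs_lt] at hF ⊢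
    constructor <;> linarith
  have := key.const_sub (l (⋃ i, S i))
  simp only [sub_sub_cancel, sub_zero] at this
  exact this

instance : CompleteSpace (ca X) := isClosed_ca.completeSpace_coe

/-! ### Measures with a density as elements of `ca` -/

open Classical in
/-- The measure `E ↦ ∫_E f dμ`, as an element of `ca`. -/
noncomputable def ofDensity (μ : Measure X) (f : X → ℝ) (hf : Integrable f μ) : ca X :=
  ⟨{ toFun := fun E => if MeasurableSet E then ∫ x in E, f x ∂μ else 0
     not_measurable' := fun _ hE => if_neg hE
     empty' := by simp
     union' := fun s t hs ht hst => by
      rw [if_pos hs, if_pos ht, if_pos (hs.union ht)]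
      exact setIntegral_union hst ht hf.integrableOn hf.integrableOn
     bounded' := ⟨∫ x, ‖f x‖ ∂μ, fun s => by
      split_ifs
      · exact (norm_integral_le_integral_norm _).trans
          (setIntegral_le_integral hf.norm (Eventually.of_forall fun _ => norm_nonneg _))
      · rw [abs_zero]
        exact integral_nonneg fun _ => norm_nonneg _⟩ },
   fun S hS hd => by
    have h := hasSum_integral_iUnion hS hd (hf.integrableOn (s := ⋃ i, S i))
    simpa only [hS, MeasurableSet.iUnion hS, if_true] using h⟩

theorem ofDensity_apply (μ : Measure X) {f : X → ℝ} (hf : Integrable f μ) {E : Set X}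
    (hE : MeasurableSet E) : (ofDensity μ f hf : FinAddMeasure X) E = ∫ x in E, f x ∂μ :=
  if_pos hE

theorem ca_ext {μ ν : ca X}
    (h : ∀ E, MeasurableSet E → (μ : FinAddMeasure X) E = (ν : FinAddMeasure X) E) : μ = ν :=
  Subtype.ext (FinAddMeasure.ext h)

theorem norm_ofDensity_le (μ : Measure X) {f : X → ℝ} (hf : Integrable f μ) :
    ‖ofDensity μ f hf‖ ≤ 2 * ∫ x, ‖f x‖ ∂μ := by
  refine norm_le_two_mul _ (integral_nonneg fun _ => norm_nonneg _) fun E hE => ?_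
  refine (congrArg abs (ofDensity_apply μ hf hE)).le.trans ?_
  exact (norm_integral_le_integral_norm _).trans
    (setIntegral_le_integral hf.norm (Eventually.of_forall fun _ => norm_nonneg _))

theorem ofDensity_sub (μ : Measure X) {f g : X → ℝ} (hf : Integrable f μ) (hg : Integrable g μ) :
    ofDensity μ f hf - ofDensity μ g hg = ofDensity μ (fun x => f x - g x) (hf.sub hg) := by
  refine ca_ext fun E hE => ?_
  rw [ofDensity_apply _ _ hE]
  change (ofDensity μ f hf : FinAddMeasure X) E - (ofDensity μ g hg : FinAddMeasure X) E = _
  rw [ofDensity_apply _ _ hE, ofDensity_apply _ _ hE,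
    integral_sub hf.integrableOn hg.integrableOn]

theorem integral_ofDensity (μ : Measure X) {f : X → ℝ} (hf : Integrable f μ) {g : X → ℝ}
    (hg : Measurable g) {C : ℝ} (hC : ∀ x, |g x| ≤ C) :
    (ofDensity μ f hf : FinAddMeasure X).integral g = ∫ x, g x * f x ∂μ := by
  have := uniformApprox_neBot hg hC
  have hmul : ∀ (h : X → ℝ), Measurable h → ∀ D, (∀ x, |h x| ≤ D) →
      Integrable (fun x => h x * f x) μ := fun h hm D hD =>
    hf.bdd_mul hm.aestronglyMeasurable (Eventually.of_forall hD)
  refine tendsto_nhds_unique (tendsto_integral _ hg hC) ?_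
  have hs : ∀ s : SimpleFunc X ℝ,
      (ofDensity μ f hf : FinAddMeasure X).simpleIntegral s = ∫ x, s x * f x ∂μ := by
    intro s
    have e : ∀ x, s x * f x = ∑ c ∈ s.range, c * (s ⁻¹' {c}).indicator f x := by
      intro x
      rw [Finset.sum_eq_single (s x)]
      · simp
      · intro c _ hc
        rw [Set.indicator_of_notMem (by simpa using hc.symm), mul_zero]
      · intro h
        exact absurd (s.mem_range_self x) h
    simp only [e]
    rw [integral_finsetSum _ fun c _ => (hf.indicator (s.measurableSet_fiber c)).const_mul c]
    refine Finset.sum_congr rfl fun c _ => ?_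
    rw [ofDensity_apply _ _ (s.measurableSet_fiber c), integral_const_mul,
      integral_indicator (s.measurableSet_fiber c)]
  rw [(hasBasis_uniformApprox g).tendsto_iff Metric.nhds_basis_closedBall]
  intro ε hε
  have hpos : 0 < (∫ x, ‖f x‖ ∂μ) + 1 :=
    add_pos_of_nonneg_of_pos (integral_nonneg fun _ => norm_nonneg _) one_pos
  refine ⟨ε / ((∫ x, ‖f x‖ ∂μ) + 1), by positivity, fun s h => ?_⟩
  have hsb : ∀ x, |s x| ≤ C + ε / ((∫ x, ‖f x‖ ∂μ) + 1) := fun x => by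
    have h1 := abs_le.1 (h x)
    have h2 := abs_le.1 (hC x)
    rw [abs_le]
    constructor <;> linarith
  rw [mem_closedBall_iff_norm', hs, ← MeasureTheory.integral_sub (hmul g hg C hC)
    (hmul s s.measurable _ hsb)]
  calc ‖∫ x, (g x * f x - s x * f x) ∂μ‖
      ≤ ∫ x, ε / ((∫ x, ‖f x‖ ∂μ) + 1) * ‖f x‖ ∂μ := by
        refine norm_integral_le_of_norm_le (hf.norm.const_mul _) (Eventually.of_forall fun x => ?_)
        rw [← sub_mul, norm_mul]
        exact mul_le_mul_of_nonneg_right (h x) (norm_nonneg _)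
    _ ≤ ε := by
        rw [integral_const_mul, div_mul_eq_mul_div, div_le_iff₀ hpos]
        nlinarith

/-- A finite measure, as an element of `ca`. -/
noncomputable def ofMeasure (μ : Measure X) [IsFiniteMeasure μ] : ca X :=
  ofDensity μ (fun _ => 1) (integrable_const 1)

theorem ofMeasure_apply (μ : Measure X) [IsFiniteMeasure μ] {E : Set X} (hE : MeasurableSet E) :
    (ofMeasure μ : FinAddMeasure X) E = μ.real E := by
  rw [ofMeasure, ofDensity_apply _ _ hE]
  simp

theorem ofMeasure_nonneg (μ : Measure X) [IsFiniteMeasure μ] (E : Set X) :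
    0 ≤ (ofMeasure μ : FinAddMeasure X) E := by
  by_cases hE : MeasurableSet E
  · rw [ofMeasure_apply μ hE]
    exact measureReal_nonneg
  · rw [FinAddMeasure.not_measurable' _ E hE]

theorem norm_ofMeasure (μ : Measure X) [IsFiniteMeasure μ] : ‖ofMeasure μ‖ = μ.real Set.univ := by
  rw [← ofMeasure_apply μ MeasurableSet.univ]
  exact norm_eq_of_nonneg _ (ofMeasure_nonneg μ)

theorem ofMeasure_injective {μ ν : Measure X} [IsFiniteMeasure μ] [IsFiniteMeasure ν]
    (h : ofMeasure μ = ofMeasure ν) : μ = ν := by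
  refine Measure.ext fun E hE => ?_
  have h1 : μ.real E = ν.real E := by rw [← ofMeasure_apply μ hE, h, ofMeasure_apply ν hE]
  exact (measureReal_eq_measureReal_iff (by finiteness) (by finiteness)).1 h1

theorem ofMeasure_add (μ ν : Measure X) [IsFiniteMeasure μ] [IsFiniteMeasure ν] :
    ofMeasure (μ + ν) = ofMeasure μ + ofMeasure ν := by
  refine ca_ext fun E hE => ?_
  rw [ofMeasure_apply _ hE, measureReal_add_apply]
  change _ = (ofMeasure μ : FinAddMeasure X) E + (ofMeasure ν : FinAddMeasure X) E
  rw [ofMeasure_apply _ hE, ofMeasure_apply _ hE]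

theorem integral_ofMeasure (μ : Measure X) [IsFiniteMeasure μ] {g : X → ℝ}
    (hg : Measurable g) {C : ℝ} (hC : ∀ x, |g x| ≤ C) :
    (ofMeasure μ : FinAddMeasure X).integral g = ∫ x, g x ∂μ := by
  rw [ofMeasure, integral_ofDensity _ _ hg hC]
  simp

theorem exists_eq_ofMeasure_sub (ν : ca X) : ∃ (μ₁ μ₂ : Measure X) (_ : IsFiniteMeasure μ₁)
    (_ : IsFiniteMeasure μ₂) (H : Set X), MeasurableSet H ∧ μ₁ Hᶜ = 0 ∧ μ₂ H = 0 ∧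
      ν = ofMeasure μ₁ - ofMeasure μ₂ := by
  set s := ν.1.toSignedMeasure ν.2 with hs
  obtain ⟨S, hS, h1, h2⟩ := s.toJordanDecomposition.mutuallySingular
  refine ⟨s.toJordanDecomposition.posPart, s.toJordanDecomposition.negPart, inferInstance,
    inferInstance, Sᶜ, hS.compl, by rwa [compl_compl], h2, ca_ext fun E hE => ?_⟩
  change ν.1 E = (ofMeasure s.toJordanDecomposition.posPart).1 E
    - (ofMeasure s.toJordanDecomposition.negPart).1 E
  rw [ofMeasure_apply _ hE, ofMeasure_apply _ hE]
  exact SignedMeasure.apply_eq_posPart_real_sub_negPart_real s hE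

theorem exists_eq_ofMeasure {ν : ca X} (hν : ∀ E, 0 ≤ ν.1 E) :
    ∃ (μ : Measure X) (_ : IsFiniteMeasure μ), ν = ofMeasure μ := by
  obtain ⟨μ₁, μ₂, _, _, H, hH, h1, h2, e⟩ := exists_eq_ofMeasure_sub ν
  have hap : ∀ E, MeasurableSet E → ν.1 E = μ₁.real E - μ₂.real E := fun E hE => by
    rw [e, ← ofMeasure_apply μ₁ hE, ← ofMeasure_apply μ₂ hE]
    rfl
  have h3 : μ₂ = 0 := by
    rw [← Measure.measure_univ_eq_zero, ← Set.union_compl_self H]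
    refine measure_union_null h2 ?_
    have h4 := hν Hᶜ
    rw [hap _ hH.compl, measureReal_def, h1, ENNReal.toReal_zero, zero_sub] at h4
    have h5 : μ₂.real Hᶜ = 0 := le_antisymm (by linarith) measureReal_nonneg
    exact (measureReal_eq_zero_iff (by finiteness)).1 h5
  refine ⟨μ₁, inferInstance, ca_ext fun E hE => ?_⟩
  rw [hap E hE, h3, ofMeasure_apply _ hE]
  simp

/-- The total variation is the total mass of the two parts of a Hahn decomposition. -/
theorem norm_ofMeasure_sub {μ₁ μ₂ : Measure X} [IsFiniteMeasure μ₁] [IsFiniteMeasure μ₂]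
    {H : Set X} (hH : MeasurableSet H) (h1 : μ₁ Hᶜ = 0) (h2 : μ₂ H = 0) :
    ‖ofMeasure μ₁ - ofMeasure μ₂‖ = μ₁.real Set.univ + μ₂.real Set.univ := by
  classical
  refine le_antisymm ((norm_sub_le _ _).trans (by rw [norm_ofMeasure, norm_ofMeasure])) ?_
  have hap : ∀ E, MeasurableSet E →
      (ofMeasure μ₁ - ofMeasure μ₂ : ca X).1 E = μ₁.real E - μ₂.real E := fun E hE => by
    rw [← ofMeasure_apply μ₁ hE, ← ofMeasure_apply μ₂ hE]
    rfl
  have e1 : (ofMeasure μ₁ - ofMeasure μ₂ : ca X).1 H = μ₁.real Set.univ := by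
    rw [hap H hH, ← measureReal_add_measureReal_compl (μ := μ₁) hH]
    simp [measureReal_def, h1, h2]
  have e2 : (ofMeasure μ₁ - ofMeasure μ₂ : ca X).1 Hᶜ = - μ₂.real Set.univ := by
    rw [hap _ hH.compl, ← measureReal_add_measureReal_compl (μ := μ₂) hH]
    simp [measureReal_def, h1, h2]
  rcases eq_or_ne H Hᶜ with h | h
  · have hz : μ₁.real Set.univ = 0 ∧ μ₂.real Set.univ = 0 := by
      have a := measureReal_add_measureReal_compl (μ := μ₁) hH
      have b := measureReal_add_measureReal_compl (μ := μ₂) hH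
      rw [← h] at a b
      have h1' : μ₁ H = 0 := by rw [h]; exact h1
      simp [measureReal_def, h1'] at a
      simp [measureReal_def, h2] at b
      constructor
      · rw [measureReal_def, ← a]
      · rw [measureReal_def, ← b]
    rw [hz.1, hz.2, add_zero]
    exact norm_nonneg _
  · have := (ofMeasure μ₁ - ofMeasure μ₂ : ca X).1.sum_abs_le_norm {H, Hᶜ}
      (by simp [hH, hH.compl]) (by
        intro s hs t ht hst
        simp only [Finset.coe_insert, Finset.coe_singleton, Set.mem_insert_iff,
          Set.mem_singleton_iff] at hs ht
        rcases hs with rfl | rfl <;> rcases ht with rfl | rfl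
        · exact absurd rfl hst
        · exact disjoint_compl_right
        · exact disjoint_compl_left
        · exact absurd rfl hst)
    rw [Finset.sum_pair h, e1, e2, abs_neg, abs_of_nonneg measureReal_nonneg,
      abs_of_nonneg measureReal_nonneg] at this
    exact this

end FinAddMeasure

/-! ### Cesàro averages of a contraction -/

section Cesaro

variable {V : Type*} [NormedAddCommGroup V] [NormedSpace ℝ V]

/-- The Cesàro average `(T + T² + ⋯ + Tⁿ) / n`, with the value `0` for `n = 0`. -/
noncomputable def cesaro (T : V →L[ℝ] V) (n : ℕ) : V →L[ℝ] V :=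
  (n : ℝ)⁻¹ • ∑ i ∈ Finset.Icc 1 n, T ^ i

theorem commute_cesaro (T : V →L[ℝ] V) (n : ℕ) : Commute T (cesaro T n) :=
  (Commute.sum_right _ _ _ fun _ _ => Commute.self_pow _ _).smul_right _

theorem norm_cesaro_le {T : V →L[ℝ] V} (hT : ‖T‖ ≤ 1) (n : ℕ) : ‖cesaro T n‖ ≤ 1 := by
  rw [cesaro, norm_smul, norm_inv, Real.norm_natCast]
  have h1 : ‖∑ i ∈ Finset.Icc 1 n, T ^ i‖ ≤ n := by
    refine (norm_sum_le _ _).trans ?_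
    calc ∑ i ∈ Finset.Icc 1 n, ‖T ^ i‖ ≤ ∑ i ∈ Finset.Icc 1 n, (1 : ℝ) :=
          Finset.sum_le_sum fun i hi => (norm_pow_le' T (by
            have := (Finset.mem_Icc.1 hi).1; omega)).trans (pow_le_one₀ (norm_nonneg _) hT)
      _ = n := by simp
  calc (n : ℝ)⁻¹ * ‖∑ i ∈ Finset.Icc 1 n, T ^ i‖ ≤ (n : ℝ)⁻¹ * n := by gcongr
    _ ≤ 1 := inv_mul_le_one

theorem cesaro_mul_one_sub (T : V →L[ℝ] V) (n : ℕ) :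
    cesaro T n * (1 - T) = (n : ℝ)⁻¹ • (T - T ^ (n + 1)) := by
  rw [cesaro, smul_mul_assoc]
  congr 1
  induction n with
  | zero => simp
  | succ n ih =>
    rw [Finset.sum_Icc_succ_top (by omega), add_mul, ih, mul_sub, mul_one, ← pow_succ]
    abel

theorem norm_cesaro_mul_one_sub_le {T : V →L[ℝ] V} (hT : ‖T‖ ≤ 1) (n : ℕ) :
    ‖cesaro T n * (1 - T)‖ ≤ 2 * (n : ℝ)⁻¹ := by
  rw [cesaro_mul_one_sub, norm_smul, norm_inv, Real.norm_natCast, mul_comm]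
  gcongr
  refine (norm_sub_le _ _).trans ?_
  have := (norm_pow_le' T (Nat.succ_pos n)).trans (pow_le_one₀ (norm_nonneg _) hT)
  linarith

theorem tendsto_cesaro_mul_one_sub {T : V →L[ℝ] V} (hT : ‖T‖ ≤ 1) :
    Tendsto (fun n => cesaro T n * (1 - T)) atTop (𝓝 0) := by
  refine squeeze_zero_norm (norm_cesaro_mul_one_sub_le hT) ?_
  simpa using (tendsto_inv_atTop_nhds_zero_nat (𝕜 := ℝ)).const_mul 2

theorem cesaro_apply_of_fixed {T : V →L[ℝ] V} {v : V} (hv : T v = v) {n : ℕ} (hn : n ≠ 0) :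
    cesaro T n v = v := by
  have hp : ∀ i : ℕ, (T ^ i) v = v := by
    intro i
    induction i with
    | zero => rfl
    | succ i ih => rw [pow_succ, mul_apply_eq_comp, hv, ih]
  have hn' : (n : ℝ) ≠ 0 := Nat.cast_ne_zero.2 hn
  rw [cesaro, smul_apply, sum_apply]
  simp only [hp, Finset.sum_const, Nat.card_Icc, Nat.add_sub_cancel]
  rw [← Nat.cast_smul_eq_nsmul ℝ, smul_smul, inv_mul_cancel₀ hn', one_smul]

/-- Each `1 - T ^ i` is a multiple of `1 - T`, hence so is `1 - cesaro T n`. -/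
theorem exists_one_sub_cesaro (T : V →L[ℝ] V) {n : ℕ} (hn : n ≠ 0) :
    ∃ c : V →L[ℝ] V, 1 - cesaro T n = (1 - T) * c := by
  have hn' : (n : ℝ) ≠ 0 := Nat.cast_ne_zero.2 hn
  refine ⟨(n : ℝ)⁻¹ • ∑ i ∈ Finset.Icc 1 n, ∑ j ∈ Finset.range i, T ^ j, ?_⟩
  rw [mul_smul_comm, Finset.mul_sum]
  simp only [mul_neg_geom_sum, Finset.sum_sub_distrib, Finset.sum_const, Nat.card_Icc,
    Nat.add_sub_cancel]
  rw [smul_sub, ← Nat.cast_smul_eq_nsmul ℝ, smul_smul, inv_mul_cancel₀ hn', one_smul, cesaro]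

/-- The set of vectors with convergent averages is closed. -/
theorem isClosed_setOf_tendsto_cesaro [CompleteSpace V] {T : V →L[ℝ] V} (hT : ‖T‖ ≤ 1) :
    IsClosed {v | ∃ w, Tendsto (fun n => cesaro T n v) atTop (𝓝 w)} := by
  refine isClosed_of_closure_subset fun v hv => ?_
  refine cauchySeq_tendsto_of_complete (Metric.cauchySeq_iff.2 fun ε hε => ?_)
  obtain ⟨u, ⟨w, hw⟩, huv⟩ := Metric.mem_closure_iff.1 hv (ε / 3) (by positivity)
  obtain ⟨N, hN⟩ := Metric.cauchySeq_iff.1 hw.cauchySeq (ε / 3) (by positivity)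
  have h1 : ∀ n, dist (cesaro T n v) (cesaro T n u) < ε / 3 := fun n => by
    rw [dist_eq_norm, ← map_sub]
    refine lt_of_le_of_lt ((cesaro T n).le_of_opNorm_le (norm_cesaro_le hT n) _) ?_
    rwa [one_mul, ← dist_eq_norm]
  refine ⟨N, fun m hm n hn => ?_⟩
  have h2 := hN m hm n hn
  have h3 := h1 m
  have h4 := h1 n
  rw [dist_comm] at h4
  calc dist (cesaro T m v) (cesaro T n v)
      ≤ dist (cesaro T m v) (cesaro T m u) + dist (cesaro T m u) (cesaro T n u)
        + dist (cesaro T n u) (cesaro T n v) := dist_triangle4 _ _ _ _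
    _ < ε := by linarith

theorem tendsto_cesaro_add {T : V →L[ℝ] V} {v v' : V}
    (h : ∃ w, Tendsto (fun n => cesaro T n v) atTop (𝓝 w))
    (h' : ∃ w, Tendsto (fun n => cesaro T n v') atTop (𝓝 w)) :
    ∃ w, Tendsto (fun n => cesaro T n (v + v')) atTop (𝓝 w) := by
  obtain ⟨w, hw⟩ := h
  obtain ⟨w', hw'⟩ := h'
  exact ⟨w + w', by simpa only [map_add] using hw.add hw'⟩

theorem tendsto_cesaro_smul {T : V →L[ℝ] V} {v : V} (c : ℝ)
    (h : ∃ w, Tendsto (fun n => cesaro T n v) atTop (𝓝 w)) :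
    ∃ w, Tendsto (fun n => cesaro T n (c • v)) atTop (𝓝 w) := by
  obtain ⟨w, hw⟩ := h
  exact ⟨c • w, by simpa only [map_smul] using hw.const_smul c⟩

/-- The averages tend to zero on the range of `1 - T`, hence on that of `1 - cesaro T m`. -/
theorem tendsto_cesaro_sub_cesaro {T : V →L[ℝ] V} (hT : ‖T‖ ≤ 1) {m : ℕ} (hm : m ≠ 0) (v : V) :
    Tendsto (fun n => cesaro T n (v - cesaro T m v)) atTop (𝓝 0) := by
  obtain ⟨c, hc⟩ := exists_one_sub_cesaro T hm
  have h1 : ∀ n, cesaro T n (v - cesaro T m v) = (cesaro T n * (1 - T)) (c v) := fun n => by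
    rw [mul_apply_eq_comp]
    congr 1
    exact DFunLike.congr_fun hc v
  simp only [h1]
  exact ((ContinuousLinearMap.apply ℝ V (c v)).continuous.tendsto' 0 0 (by simp)).comp
    (tendsto_cesaro_mul_one_sub hT)

theorem mem_fixed_of_tendsto_cesaro {T : V →L[ℝ] V} (hT : ‖T‖ ≤ 1) {v w : V}
    (h : Tendsto (fun n => cesaro T n v) atTop (𝓝 w)) : T w = w := by
  have h1 : Tendsto (fun n => (cesaro T n * (1 - T)) v) atTop (𝓝 0) :=
    ((ContinuousLinearMap.apply ℝ V v).continuous.tendsto' 0 0 (by simp)).comp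
      (tendsto_cesaro_mul_one_sub hT)
  have h2 : Tendsto (fun n => cesaro T n v - T (cesaro T n v)) atTop (𝓝 (w - T w)) :=
    h.sub ((T.continuous.tendsto w).comp h)
  have h3 : ∀ n, (cesaro T n * (1 - T)) v = cesaro T n v - T (cesaro T n v) := fun n => by
    rw [mul_sub, mul_one, ← (commute_cesaro T n).eq]
    rfl
  simp only [h3] at h1
  exact (sub_eq_zero.1 (tendsto_nhds_unique h2 h1)).symm

/-- The mean ergodic projection: if all averages converge, the limit is a bounded projection onto
the fixed space that absorbs `T`. -/
theorem exists_mean_ergodic_projection [CompleteSpace V] {T : V →L[ℝ] V} (hT : ‖T‖ ≤ 1)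
    (h : ∀ v, ∃ w, Tendsto (fun n => cesaro T n v) atTop (𝓝 w)) :
    ∃ E : V →L[ℝ] V, (∀ v, Tendsto (fun n => cesaro T n v) atTop (𝓝 (E v))) ∧
      T * E = E ∧ E * T = E ∧ E * E = E ∧ Set.range E = {v | T v = v} := by
  choose f hf using h
  let E := continuousLinearMapOfTendsto (cesaro T) (tendsto_pi_nhds.2 hf)
  have hE : ∀ v, Tendsto (fun n => cesaro T n v) atTop (𝓝 (E v)) := hf
  have hfix : ∀ v, T v = v → E v = v := fun v hv =>
    tendsto_nhds_unique (hE v) (tendsto_const_nhds.congr' (by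
      filter_upwards [eventually_ne_atTop 0] with n hn
      rw [cesaro_apply_of_fixed hv hn]))
  have hTE : ∀ v, T (E v) = E v := fun v => mem_fixed_of_tendsto_cesaro hT (hE v)
  refine ⟨E, hE, ContinuousLinearMap.ext hTE, ContinuousLinearMap.ext fun v => ?_,
    ContinuousLinearMap.ext fun v => hfix _ (hTE v), ?_⟩
  · have h1 := (T.continuous.tendsto _).comp (hE v)
    have h2 := hE (T v)
    have h3 : ∀ n, cesaro T n (T v) = T (cesaro T n v) := fun n =>
      (DFunLike.congr_fun (commute_cesaro T n).eq v).symm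
    simp only [h3] at h2
    exact (tendsto_nhds_unique h2 h1).trans (hTE v)
  · ext v
    constructor
    · rintro ⟨u, rfl⟩
      exact hTE u
    · intro hv
      exact ⟨v, hfix v hv⟩

/-- If the square of one difference `cesaro T m - E` has norm less than one, then `1 - T` is
invertible on the kernel of the mean ergodic projection `E`: the Neumann series inverts
`1 - (cesaro T m)²`, which is a multiple of `1 - T`. -/
theorem isSpectralProjection_of_norm_lt_one [CompleteSpace V] {T E : V →L[ℝ] V} (hT : ‖T‖ ≤ 1)
    (hTE : T * E = E) (hET : E * T = E) (hEE : E * E = E) {m : ℕ} (hm : m ≠ 0)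
    (hlt : ‖(cesaro T m - E) * (cesaro T m - E)‖ < 1) :
    IsSpectralProjection T 1 E ∧ Tendsto (fun n => cesaro T n) atTop (𝓝 E) := by
  have hpow : ∀ i : ℕ, T ^ i * E = E := by
    intro i
    induction i with
    | zero => rw [pow_zero, one_mul]
    | succ i ih => rw [pow_succ, mul_assoc, hTE, ih]
  have hces : ∀ n : ℕ, n ≠ 0 → cesaro T n * E = E := by
    intro n hn
    have hn' : (n : ℝ) ≠ 0 := Nat.cast_ne_zero.2 hn
    rw [cesaro, smul_mul_assoc, Finset.sum_mul]
    simp only [hpow, Finset.sum_const, Nat.card_Icc, Nat.add_sub_cancel]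
    rw [← Nat.cast_smul_eq_nsmul ℝ, smul_smul, inv_mul_cancel₀ hn', one_smul]
  have hcomE : ∀ n, Commute E (cesaro T n) := fun n =>
    (Commute.sum_right _ _ _ fun i _ =>
      (show Commute E T from hET.trans hTE.symm).pow_right i).smul_right _
  set C := cesaro T m with hC
  have hCE : C * E = E := hces m hm
  have hEC : E * C = E := (hcomE m).eq.trans hCE
  have hsq : (C - E) * (C - E) = C * C - E := by
    rw [sub_mul, mul_sub, mul_sub, hCE, hEC, hEE]
    abel
  rw [hsq] at hlt
  obtain ⟨c, hc⟩ := exists_one_sub_cesaro T hm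
  have hu : IsUnit (1 - (C * C - E)) := isUnit_one_sub_of_norm_lt_one hlt
  obtain ⟨W, hW⟩ := hu.exists_right_inv
  have hG : (1 - T) * (c * (1 + C) * W * (1 - E)) = 1 - E := by
    have e1 : (1 - T) * (c * (1 + C)) = 1 - C * C := by
      rw [← mul_assoc, ← hc, ← hC, sub_mul, mul_add, mul_add]
      simp only [one_mul, mul_one]
      abel
    have e2 : (1 - E) * (1 - (C * C - E)) = 1 - C * C := by
      have e : E * (1 - (C * C - E)) = E := by
        rw [mul_sub, mul_sub, ← mul_assoc, hEC, hEC, hEE, mul_one, sub_self, sub_zero]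
      rw [sub_mul, e, one_mul]
      abel
    have e3 : (1 - E) * (1 - E) = 1 - E := by
      rw [mul_sub, mul_one, sub_mul, one_mul, hEE, sub_self, sub_zero]
    calc (1 - T) * (c * (1 + C) * W * (1 - E)) = (1 - T) * (c * (1 + C)) * W * (1 - E) := by
          simp only [mul_assoc]
      _ = (1 - E) * ((1 - (C * C - E)) * W) * (1 - E) := by
          rw [e1, ← e2]
          simp only [mul_assoc]
      _ = 1 - E := by rw [hW, mul_one, e3]
  set G := c * (1 + C) * W * (1 - E) with hGdef
  have hlim : Tendsto (fun n => cesaro T n) atTop (𝓝 E) := by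
    have h1 : Tendsto (fun n => cesaro T n * (1 - T) * G + E) atTop (𝓝 (0 * G + E)) :=
      ((tendsto_cesaro_mul_one_sub hT).mul_const G).add_const E
    rw [zero_mul, zero_add] at h1
    refine h1.congr' ?_
    filter_upwards [eventually_ne_atTop 0] with n hn
    rw [mul_assoc, hG, mul_sub, mul_one, hces n hn]
    abel
  refine ⟨⟨hEE, hET.trans hTE.symm, ?_, ?_, ?_, ?_⟩, hlim⟩
  · refine tendsto_const_nhds.congr' ?_
    filter_upwards [eventually_ne_atTop 0] with n hn
    rw [sub_mul, hTE, one_smul, one_mul, sub_self, zero_pow hn, norm_zero,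
      Real.zero_rpow (by positivity)]
  · intro v hv
    have h1 : E (T v) = E v := DFunLike.congr_fun hET v
    change E (T v - (1 : ℝ) • v) = 0
    rw [one_smul, map_sub, h1, sub_self]
  · -- a fixed vector equals its averages, which converge to its image under `E`
    intro v hv u hu huv
    change E v = 0 at hv
    change E u = 0 at hu
    have h1 : T (v - u) = v - u := by
      simp only [one_smul] at huv
      rw [map_sub]
      have := sub_eq_sub_iff_add_eq_add.1 huv
      rw [sub_eq_sub_iff_add_eq_add, this, add_comm]
    have h2 : Tendsto (fun n => cesaro T n (v - u)) atTop (𝓝 (E (v - u))) :=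
      ((ContinuousLinearMap.apply ℝ V (v - u)).continuous.tendsto _).comp hlim
    have h3 : E (v - u) = v - u := tendsto_nhds_unique h2 (tendsto_const_nhds.congr' (by
      filter_upwards [eventually_ne_atTop 0] with n hn
      rw [cesaro_apply_of_fixed h1 hn]))
    rw [map_sub, hv, hu, sub_self] at h3
    exact sub_eq_zero.1 h3.symm
  · intro v hv
    change E v = 0 at hv
    have h1 : (1 - T) (G v) = v := by
      have := DFunLike.congr_fun hG v
      rw [mul_apply_eq_comp] at this
      rw [this, sub_apply, hv, sub_zero]
      rfl
    have h2 : G v - T (G v) = v := h1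
    refine ⟨-(G v - E (G v)), ?_, ?_⟩
    · have h3 : E (E (G v)) = E (G v) := DFunLike.congr_fun hEE (G v)
      change E (-(G v - E (G v))) = 0
      rw [map_neg, map_sub, h3, sub_self, neg_zero]
    · have h3 : T (E (G v)) = E (G v) := DFunLike.congr_fun hTE (G v)
      simp only [one_smul, map_neg, map_sub, h3]
      refine Eq.trans ?_ h2
      abel

end Cesaro

/-! ### Limits of almost invariant probability measures -/

namespace FinAddMeasure

variable {X : Type*} [MeasurableSpace X]

/-- Evaluation at a set, as a bounded functional on `ca`. -/
noncomputable def evalCA (E : Set X) : ca X →L[ℝ] ℝ :=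
  LinearMap.mkContinuous
    { toFun := fun μ => μ.1 E
      map_add' := fun _ _ => rfl
      map_smul' := fun _ _ => rfl } 1 fun μ => by
    rw [one_mul]
    exact abs_apply_le_norm μ.1 E

theorem evalCA_apply (E : Set X) (μ : ca X) : evalCA E μ = μ.1 E := rfl

theorem evalCA_ofMeasure (μ : Measure X) [IsFiniteMeasure μ] {E : Set X} (hE : MeasurableSet E) :
    evalCA E (ofMeasure μ) = μ.real E := ofMeasure_apply μ hE

theorem abs_integral_sub_simpleIntegral_le (μ : FinAddMeasure X) {f : X → ℝ} (hf : Measurable f)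
    {C : ℝ} (hC : ∀ x, |f x| ≤ C) (s : SimpleFunc X ℝ) {r : ℝ} (hr : 0 < r)
    (hs : ∀ x, |f x - s x| ≤ r) : |μ.integral f - μ.simpleIntegral s| ≤ 2 * r * ‖μ‖ := by
  have := uniformApprox_neBot hf hC
  refine le_of_tendsto ((μ.tendsto_integral hf hC).sub_const _).abs ?_
  filter_upwards [(hasBasis_uniformApprox f).mem_of_mem hr] with t ht
  rw [← simpleIntegral_sub]
  refine abs_simpleIntegral_le _ _ fun x => ?_
  have h1 := abs_le.1 (hs x)
  have h2 := abs_le.1 (ht x)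
  rw [SimpleFunc.coe_sub, Pi.sub_apply, abs_le]
  constructor <;> linarith

/-- Setwise convergence of bounded families implies convergence of the integrals of bounded
measurable functions. -/
theorem tendsto_integral_of_tendsto {ι : Type*} {l : Filter ι} {u : ι → FinAddMeasure X}
    {μ : FinAddMeasure X} {B : ℝ} (hu : ∀ i, ‖u i‖ ≤ B) (hμ : ‖μ‖ ≤ B)
    (h : ∀ s, Tendsto (fun i => u i s) l (𝓝 (μ s))) {f : X → ℝ} (hf : Measurable f) {C : ℝ}
    (hC : ∀ x, |f x| ≤ C) :
    Tendsto (fun i => (u i).integral f) l (𝓝 (μ.integral f)) := by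
  rw [Metric.tendsto_nhds]
  intro ε hε
  have hB : 0 ≤ B := (norm_nonneg μ).trans hμ
  have hr : 0 < ε / (8 * (B + 1)) := by positivity
  have := uniformApprox_neBot hf hC
  obtain ⟨s, hs⟩ : ∃ s : SimpleFunc X ℝ, ∀ x, |f x - s x| ≤ ε / (8 * (B + 1)) :=
    ((hasBasis_uniformApprox f).mem_of_mem hr |> Filter.nonempty_of_mem)
  have hb : ∀ ν : FinAddMeasure X, ‖ν‖ ≤ B → |ν.integral f - ν.simpleIntegral s| ≤ ε / 4 := by
    intro ν hν
    refine (abs_integral_sub_simpleIntegral_le ν hf hC s hr hs).trans ?_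
    calc 2 * (ε / (8 * (B + 1))) * ‖ν‖ ≤ 2 * (ε / (8 * (B + 1))) * (B + 1) := by
          gcongr; linarith
      _ = ε / 4 := by field_simp; norm_num
  have hs' : Tendsto (fun i => (u i).simpleIntegral s) l (𝓝 (μ.simpleIntegral s)) :=
    tendsto_finsetSum _ fun c _ => (h _).const_mul c
  filter_upwards [Metric.tendsto_nhds.1 hs' (ε / 4) (by positivity)] with i hi
  have h1 := abs_le.1 (hb _ (hu i))
  have h2 := abs_le.1 (hb _ hμ)
  rw [Real.dist_eq] at hi ⊢
  have h3 := abs_lt.1 hi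
  rw [abs_lt]
  constructor <;> linarith

end FinAddMeasure

section Invariant

open FinAddMeasure

variable {X : Type*} [MeasurableSpace X] (p : Kernel X X) [IsMarkovKernel p]

theorem markovCA_coe (μ : ca X) : (markovCA p μ : FinAddMeasure X) = markovBA p μ := rfl

theorem integral_transition (μ : Measure X) [IsFiniteMeasure μ] {E : Set X}
    (hE : MeasurableSet E) : ∫ x, (p x).real E ∂μ = (p ∘ₘ μ).real E := by
  rw [measureReal_def, Measure.bind_apply hE p.aemeasurable]
  exact integral_toReal (p.measurable_coe hE).aemeasurable
    (Eventually.of_forall fun x => measure_lt_top _ _)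

theorem markovCA_ofMeasure (μ : Measure X) [IsFiniteMeasure μ] :
    markovCA p (ofMeasure μ) = ofMeasure (p ∘ₘ μ) := by
  refine ca_ext fun E hE => ?_
  rw [markovCA_coe, markovBA_apply p _ hE,
    integral_ofMeasure μ (measurable_transition p hE) (abs_transition_le p E),
    integral_transition p μ hE, ofMeasure_apply _ hE]

theorem norm_markovCA_le : ‖markovCA p‖ ≤ 1 := by
  refine ContinuousLinearMap.opNorm_le_bound _ zero_le_one fun ν => ?_
  obtain ⟨μ₁, μ₂, _, _, H, hH, h1, h2, rfl⟩ := exists_eq_ofMeasure_sub ν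
  rw [one_mul, norm_ofMeasure_sub hH h1 h2, map_sub, markovCA_ofMeasure, markovCA_ofMeasure]
  refine (norm_sub_le _ _).trans ?_
  rw [norm_ofMeasure, norm_ofMeasure]
  simp only [measureReal_def, Measure.comp_apply_univ, le_refl]

theorem markovCA_ofMeasure_eq_iff (μ : Measure X) [IsFiniteMeasure μ] :
    markovCA p (ofMeasure μ) = ofMeasure μ ↔ p ∘ₘ μ = μ := by
  rw [markovCA_ofMeasure]
  refine ⟨ofMeasure_injective, fun h => ?_⟩
  congr

theorem comp_eq_of_le {μ : Measure X} [IsFiniteMeasure μ] (h : p ∘ₘ μ ≤ μ) : p ∘ₘ μ = μ :=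
  Measure.eq_of_le_of_measure_univ_eq h Measure.comp_apply_univ

theorem comp_eq_of_ge {μ : Measure X} [IsFiniteMeasure μ] (h : μ ≤ p ∘ₘ μ) : p ∘ₘ μ = μ :=
  (Measure.eq_of_le_of_measure_univ_eq h Measure.comp_apply_univ.symm).symm

/-- Both parts of the Jordan decomposition of an invariant measure are invariant. -/
theorem comp_eq_of_ofMeasure_sub {μ₁ μ₂ : Measure X} [IsFiniteMeasure μ₁] [IsFiniteMeasure μ₂]
    {H : Set X} (hH : MeasurableSet H) (h1 : μ₁ Hᶜ = 0) (h2 : μ₂ H = 0)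
    (hinv : markovCA p (ofMeasure μ₁ - ofMeasure μ₂) = ofMeasure μ₁ - ofMeasure μ₂) :
    p ∘ₘ μ₁ = μ₁ ∧ p ∘ₘ μ₂ = μ₂ := by
  have key : p ∘ₘ μ₁ = μ₁ := by
    refine comp_eq_of_ge p (Measure.le_iff.2 fun E hE => ?_)
    have hm := hE.inter hH
    have e := congrArg (evalCA (E ∩ H)) hinv
    rw [map_sub, map_sub, map_sub, markovCA_ofMeasure, markovCA_ofMeasure,
      evalCA_ofMeasure _ hm, evalCA_ofMeasure _ hm, evalCA_ofMeasure _ hm,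
      evalCA_ofMeasure _ hm, measureReal_def μ₂, measure_inter_null_of_null_right E h2,
      ENNReal.toReal_zero, sub_zero] at e
    have h3 : (0 : ℝ) ≤ (p ∘ₘ μ₂).real (E ∩ H) := measureReal_nonneg
    have h4 : μ₁.real (E ∩ H) ≤ (p ∘ₘ μ₁).real (E ∩ H) := by linarith
    rw [measureReal_def, measureReal_def,
      ENNReal.toReal_le_toReal (by finiteness) (by finiteness)] at h4
    calc μ₁ E = μ₁ (E ∩ H) := by
          rw [← measure_inter_add_sdiff E hH, Set.sdiff_eq, measure_inter_null_of_null_right E h1,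
            add_zero]
      _ ≤ (p ∘ₘ μ₁) (E ∩ H) := h4
      _ ≤ (p ∘ₘ μ₁) E := measure_mono Set.inter_subset_left
  refine ⟨key, (markovCA_ofMeasure_eq_iff p μ₂).1 ?_⟩
  rw [map_sub, (markovCA_ofMeasure_eq_iff p μ₁).2 key] at hinv
  exact sub_right_injective hinv

/-- The singular part of an invariant measure with respect to another one is invariant. -/
theorem comp_singularPart_eq {μ σ : Measure X} [IsFiniteMeasure μ] [IsFiniteMeasure σ]
    (hμ : p ∘ₘ μ = μ) (hσ : p ∘ₘ σ = σ) : p ∘ₘ μ.singularPart σ = μ.singularPart σ := by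
  set s := μ.singularPart σ
  set a := σ.withDensity (μ.rnDeriv σ)
  have hsum : μ = s + a := Measure.haveLebesgueDecomposition_add μ σ
  have ha : a ≪ σ := withDensity_absolutelyContinuous _ _
  have : IsFiniteMeasure a := isFiniteMeasure_of_le μ (hsum ▸ Measure.le_add_left le_rfl)
  obtain ⟨S, hS, h1, h2⟩ := Measure.mutuallySingular_singularPart μ σ
  have hpa : (p ∘ₘ a) Sᶜ = 0 := by
    refine (ha.comp_right p) ?_
    rw [hσ]
    exact h2
  have hle : p ∘ₘ a ≤ μ := by
    conv_rhs => rw [← hμ, hsum, Measure.comp_add]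
    exact Measure.le_add_left le_rfl
  have hai : p ∘ₘ a = a := by
    refine comp_eq_of_le p (Measure.le_iff.2 fun E hE => ?_)
    calc (p ∘ₘ a) E = (p ∘ₘ a) (E ∩ S) := by
          rw [← measure_inter_add_sdiff E hS, Set.sdiff_eq, measure_inter_null_of_null_right E hpa,
            add_zero]
      _ ≤ μ (E ∩ S) := hle _
      _ = a (E ∩ S) := by
          rw [hsum, Measure.add_apply, measure_inter_null_of_null_right E h1, zero_add]
      _ ≤ a E := measure_mono Set.inter_subset_left
  refine (markovCA_ofMeasure_eq_iff p s).1 ?_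
  have e : ofMeasure s = ofMeasure μ - ofMeasure a := by
    rw [eq_sub_iff_add_eq, ← ofMeasure_add]
    congr 1
    exact hsum.symm
  rw [e, map_sub, (markovCA_ofMeasure_eq_iff p μ).2 hμ, (markovCA_ofMeasure_eq_iff p a).2 hai]

theorem ofMeasure_mem_invProbBA (μ : Measure X) [IsProbabilityMeasure μ] (h : p ∘ₘ μ = μ) :
    (ofMeasure μ : FinAddMeasure X) ∈ invProbBA p := by
  refine ⟨ofMeasure_nonneg μ, (norm_ofMeasure μ).trans (by simp), ?_⟩
  rw [← markovCA_coe, (markovCA_ofMeasure_eq_iff p μ).2 h]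

/-- If every invariant finitely additive probability is countably additive, then almost invariant
probability measures have an invariant probability measure as a limit along an ultrafilter. -/
theorem exists_invariant_limit (hstar : invProbBA p ⊆ (ca X : Set (FinAddMeasure X)))
    (ν : ℕ → Measure X) [∀ k, IsProbabilityMeasure (ν k)]
    (h : Tendsto (fun k => markovCA p (ofMeasure (ν k)) - ofMeasure (ν k)) atTop (𝓝 0)) :
    ∃ π : Measure X, IsProbabilityMeasure π ∧ p ∘ₘ π = π ∧ ∀ E, MeasurableSet E →
      Tendsto (fun k => (ν k).real E) (hyperfilter ℕ) (𝓝 (π.real E)) := by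
  let u : ℕ → FinAddMeasure X := fun k => ofMeasure (ν k)
  have hu : ∀ k, ‖u k‖ ≤ 1 := fun k => ((norm_ofMeasure (ν k)).trans (by simp)).le
  have hIcc : ∀ k s, u k s ∈ Set.Icc (0 : ℝ) 1 := fun k s =>
    ⟨ofMeasure_nonneg (ν k) s, (le_abs_self _).trans ((abs_apply_le_norm (u k) s).trans (hu k))⟩
  have hlim : ∀ s, ∃ a, a ∈ Set.Icc (0 : ℝ) 1 ∧
      Tendsto (fun k => u k s) (hyperfilter ℕ) (𝓝 a) := by
    intro s
    obtain ⟨a, ha, hle⟩ := isCompact_Icc.ultrafilter_le_nhds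
      ((hyperfilter ℕ).map fun k => u k s)
      (le_principal_iff.2 (Filter.mem_map.2 (univ_mem' fun k => hIcc k s)))
    exact ⟨a, ha, hle⟩
  choose L hL0 hL using hlim
  let l : FinAddMeasure X :=
    { toFun := L
      not_measurable' := fun s hs => tendsto_nhds_unique (hL s) (by
        simp only [(u _).not_measurable' s hs]
        exact tendsto_const_nhds)
      empty' := tendsto_nhds_unique (hL ∅) (by
        simp only [(u _).empty']
        exact tendsto_const_nhds)
      union' := fun s t hs ht hst => tendsto_nhds_unique (hL (s ∪ t)) (by
        simp only [(u _).union' s t hs ht hst]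
        exact (hL s).add (hL t))
      bounded' := ⟨1, fun s => abs_le.2 ⟨by linarith [(hL0 s).1], (hL0 s).2⟩⟩ }
  have hl0 : ∀ s, 0 ≤ l s := fun s => (hL0 s).1
  have hl1 : ‖l‖ = 1 := by
    rw [norm_eq_of_nonneg l hl0]
    refine tendsto_nhds_unique (hL Set.univ) (tendsto_const_nhds.congr fun k => ?_)
    change 1 = (ofMeasure (ν k) : FinAddMeasure X) Set.univ
    rw [ofMeasure_apply _ MeasurableSet.univ]
    simp
  have hinv : markovBA p l = l := by
    refine FinAddMeasure.ext fun E hE => ?_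
    rw [markovBA_apply p l hE]
    have h1 : Tendsto (fun k => (u k).integral fun x => (p x).real E) (hyperfilter ℕ)
        (𝓝 (l.integral fun x => (p x).real E)) :=
      tendsto_integral_of_tendsto hu hl1.le hL (measurable_transition p hE)
        (abs_transition_le p E)
    have h2 : Tendsto (fun k => (u k).integral (fun x => (p x).real E) - u k E)
        (hyperfilter ℕ) (𝓝 0) := by
      have h3 := (((evalCA E).continuous.tendsto' 0 0 (map_zero _)).comp h).mono_left
        Nat.hyperfilter_le_atTop
      refine h3.congr fun k => ?_
      rw [← markovBA_apply p (u k) hE]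
      rfl
    exact sub_eq_zero.1 (tendsto_nhds_unique (h1.sub (hL E)) h2)
  have hca : l ∈ ca X := hstar ⟨hl0, hl1, hinv⟩
  obtain ⟨π, _, hπ⟩ := exists_eq_ofMeasure (ν := ⟨l, hca⟩) hl0
  have hπl : ∀ E, MeasurableSet E → π.real E = l E := fun E hE => by
    rw [← ofMeasure_apply π hE, ← hπ]
  refine ⟨π, ⟨?_⟩, ?_, fun E hE => ?_⟩
  · have h1 := hπl _ MeasurableSet.univ
    rw [← norm_eq_of_nonneg l hl0, hl1] at h1
    rwa [measureReal_def, ENNReal.toReal_eq_one_iff] at h1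
  · rw [← markovCA_ofMeasure_eq_iff, ← hπ]
    exact Subtype.ext hinv
  · rw [hπl E hE]
    refine (hL E).congr fun k => ?_
    exact ofMeasure_apply (ν k) hE

end Invariant

/-! ### A dominating invariant measure and the uniform absolute continuity of the averages -/

section Dominating

open FinAddMeasure

variable {X : Type*} [MeasurableSpace X]

/-- A sequence of pairwise mutually singular measures lives on pairwise disjoint sets. -/
theorem exists_pairwise_disjoint_of_mutuallySingular (ν : ℕ → Measure X)
    (h : Pairwise (Function.onFun Measure.MutuallySingular ν)) :
    ∃ F : ℕ → Set X, (∀ j, MeasurableSet (F j)) ∧ Pairwise (Function.onFun Disjoint F) ∧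
      ∀ j, ν j (F j)ᶜ = 0 := by
  have hex : ∀ i j, ∃ S, MeasurableSet S ∧ (i ≠ j → ν i S = 0 ∧ ν j Sᶜ = 0) := by
    intro i j
    by_cases hij : i = j
    · exact ⟨∅, MeasurableSet.empty, fun h => absurd hij h⟩
    · obtain ⟨S, hS, h1, h2⟩ := h hij
      exact ⟨S, hS, fun _ => ⟨h1, h2⟩⟩
  choose S hS hν using hex
  refine ⟨fun j => ⋂ i ∈ {i | i ≠ j}, (S i j ∩ (S j i)ᶜ), fun j => ?_, fun i j hij => ?_,
    fun j => ?_⟩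
  · exact MeasurableSet.biInter (Set.to_countable _) fun i _ => (hS i j).inter (hS j i).compl
  · refine Set.disjoint_left.2 fun x hx hx' => ?_
    have h1 := Set.mem_iInter₂.1 hx j hij.symm
    have h2 := Set.mem_iInter₂.1 hx' i hij
    exact h1.2 h2.1
  · rw [Set.compl_iInter₂]
    refine (measure_biUnion_null_iff (Set.to_countable _)).2 fun i hi => ?_
    rw [Set.compl_inter, compl_compl]
    exact measure_union_null (hν i j hi).2 (hν j i (Ne.symm hi)).1

variable (p : Kernel X X) [IsMarkovKernel p]

/-- There is no infinite family of mutually singular invariant probability measures: a limit of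
such a family would give full mass to each of a decreasing sequence of sets with empty
intersection. -/
theorem not_exists_mutuallySingular_seq
    (hstar : invProbBA p ⊆ (ca X : Set (FinAddMeasure X))) (ν : ℕ → Measure X)
    (hν : ∀ k, IsProbabilityMeasure (ν k)) (hinv : ∀ k, p ∘ₘ ν k = ν k) :
    ¬ Pairwise (Function.onFun Measure.MutuallySingular ν) := by
  intro hsing
  obtain ⟨F, hF, hd, hνF⟩ := exists_pairwise_disjoint_of_mutuallySingular ν hsing
  obtain ⟨π, _, _, hlim⟩ := exists_invariant_limit p hstar ν (by
    simp only [(markovCA_ofMeasure_eq_iff p _).2 (hinv _), sub_self]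
    exact tendsto_const_nhds)
  let G : ℕ → Set X := fun k => ⋃ j ∈ {j | k ≤ j}, F j
  have hG : ∀ k, MeasurableSet (G k) := fun k =>
    MeasurableSet.biUnion (Set.to_countable _) fun j _ => hF j
  have hπG : ∀ k, π (G k) = 1 := by
    intro k
    have h1 : Tendsto (fun j => (ν j).real (G k)) (hyperfilter ℕ) (𝓝 1) := by
      refine tendsto_const_nhds.congr' ?_
      filter_upwards [Nat.hyperfilter_le_atTop (eventually_ge_atTop k)] with j hj
      have h2 : ν j (G k)ᶜ = 0 :=
        measure_mono_null (Set.compl_subset_compl.2 (Set.subset_biUnion_of_mem hj)) (hνF j)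
      rw [measureReal_def, (prob_compl_eq_zero_iff (hG k)).1 h2, ENNReal.toReal_one]
    have h3 := tendsto_nhds_unique (hlim _ (hG k)) h1
    rwa [measureReal_def, ENNReal.toReal_eq_one_iff] at h3
  have hanti : Antitone G := fun k l hkl =>
    Set.biUnion_subset_biUnion_left fun j (hj : l ≤ j) => hkl.trans hj
  have hemp : ⋂ k, G k = ∅ := by
    refine Set.eq_empty_of_forall_notMem fun x hx => ?_
    obtain ⟨j, _, hj⟩ := Set.mem_iUnion₂.1 (Set.mem_iInter.1 hx 0)
    obtain ⟨i, hi, hi'⟩ := Set.mem_iUnion₂.1 (Set.mem_iInter.1 hx (j + 1))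
    have hij : j ≠ i := by
      have : j + 1 ≤ i := hi
      omega
    exact Set.disjoint_left.1 (hd hij) hj hi'
  have h1 := tendsto_measure_iInter_atTop (μ := π) (fun k => (hG k).nullMeasurableSet) hanti
    ⟨0, measure_ne_top _ _⟩
  rw [hemp, measure_empty] at h1
  simp only [Function.comp_def, hπG] at h1
  exact zero_ne_one (tendsto_nhds_unique h1 tendsto_const_nhds)

/-- A maximal finite family of mutually singular invariant probability measures dominates all
invariant probability measures. -/
theorem exists_dominating_invariant
    (hstar : invProbBA p ⊆ (ca X : Set (FinAddMeasure X))) :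
    ∃ σ : Measure X, IsFiniteMeasure σ ∧ p ∘ₘ σ = σ ∧
      ∀ μ : Measure X, IsProbabilityMeasure μ → p ∘ₘ μ = μ → μ ≪ σ := by
  by_contra! hcon
  have : Std.Symm (Measure.MutuallySingular : Measure X → Measure X → Prop) :=
    ⟨fun _ _ h => h.symm⟩
  obtain ⟨ν, hν, hs⟩ := exists_seq_of_forall_finset_exists'
    (fun μ : Measure X => IsProbabilityMeasure μ ∧ p ∘ₘ μ = μ) Measure.MutuallySingular (by
      intro s hs
      have hfin : IsFiniteMeasure (∑ μ ∈ s, μ) ∧ p ∘ₘ (∑ μ ∈ s, μ) = ∑ μ ∈ s, μ := by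
        classical
        induction s using Finset.induction_on with
        | empty => exact ⟨by simp only [Finset.sum_empty]; infer_instance, by simp⟩
        | insert a s ha ih =>
          obtain ⟨h1, h2⟩ := ih fun x hx => hs x (Finset.mem_insert_of_mem hx)
          obtain ⟨h3, h4⟩ := hs a (Finset.mem_insert_self _ _)
          rw [Finset.sum_insert ha]
          exact ⟨inferInstance, by rw [Measure.comp_add, h2, h4]⟩
      obtain ⟨_, hinv⟩ := hfin
      obtain ⟨μ, _, hμ, hac⟩ := hcon _ inferInstance hinv
      set σ := ∑ μ ∈ s, μ with hσ
      have hne : μ.singularPart σ ≠ 0 := fun h0 => hac (by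
        rwa [Measure.singularPart_eq_zero] at h0)
      have : NeZero (μ.singularPart σ) := ⟨hne⟩
      refine ⟨((μ.singularPart σ) Set.univ)⁻¹ • μ.singularPart σ, ⟨inferInstance, ?_⟩, ?_⟩
      · rw [Measure.comp_smul, comp_singularPart_eq p hμ hinv]
      · intro x hx
        refine Measure.MutuallySingular.symm (Measure.MutuallySingular.smul _ ?_)
        exact (Measure.mutuallySingular_singularPart μ σ).mono le_rfl
          (Finset.single_le_sum (f := fun μ : Measure X => μ) (fun _ _ => Measure.zero_le _) hx))
  exact not_exists_mutuallySingular_seq p hstar ν (fun k => (hν k).1) (fun k => (hν k).2) hs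

theorem exists_pow_markovCA_ofMeasure (ν : Measure X) [IsProbabilityMeasure ν] (i : ℕ) :
    ∃ (α : Measure X) (_ : IsProbabilityMeasure α),
      (markovCA p ^ i) (ofMeasure ν) = ofMeasure α := by
  induction i with
  | zero => exact ⟨ν, inferInstance, rfl⟩
  | succ i ih =>
    obtain ⟨α, _, h⟩ := ih
    exact ⟨p ∘ₘ α, inferInstance, by
      rw [pow_succ', mul_apply_eq_comp, h, markovCA_ofMeasure]⟩

theorem exists_cesaro_markovCA_ofMeasure (ν : Measure X) [IsProbabilityMeasure ν] {m : ℕ}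
    (hm : m ≠ 0) : ∃ (α : Measure X) (_ : IsProbabilityMeasure α),
      cesaro (markovCA p) m (ofMeasure ν) = ofMeasure α := by
  choose α hα he using exists_pow_markovCA_ofMeasure p ν
  have hm' : (m : ℝ) ≠ 0 := Nat.cast_ne_zero.2 hm
  have hval : ∀ E, (cesaro (markovCA p) m (ofMeasure ν)).1 E
      = (m : ℝ)⁻¹ * ∑ i ∈ Finset.Icc 1 m, (ofMeasure (α i)).1 E := by
    intro E
    rw [← evalCA_apply, cesaro, _root_.smul_apply, sum_apply, map_smul, map_sum, smul_eq_mul]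
    simp only [he, evalCA_apply]
  obtain ⟨β, _, hβ⟩ := exists_eq_ofMeasure (ν := cesaro (markovCA p) m (ofMeasure ν))
    fun E => by
      rw [hval]
      exact mul_nonneg (by positivity) (Finset.sum_nonneg fun i _ => ofMeasure_nonneg _ _)
  refine ⟨β, ⟨?_⟩, hβ⟩
  have h1 := hval Set.univ
  rw [hβ] at h1
  simp only [ofMeasure_apply _ MeasurableSet.univ, probReal_univ, Finset.sum_const, Nat.card_Icc,
    Nat.add_sub_cancel, nsmul_eq_mul, mul_one, inv_mul_cancel₀ hm'] at h1
  rwa [measureReal_def, ENNReal.toReal_eq_one_iff] at h1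

/-- A Doeblin type condition: the averages of all probability measures are, in the limit, uniformly
absolutely continuous with respect to an invariant measure that dominates the invariant
probabilities. Otherwise an ultrafilter limit of averages would charge the upper limit of a sequence
of sets with summable measures, which is a null set. -/
theorem exists_uniform_absolutelyContinuous
    (hstar : invProbBA p ⊆ (ca X : Set (FinAddMeasure X))) {σ : Measure X} [IsFiniteMeasure σ]
    (hσ : ∀ μ : Measure X, IsProbabilityMeasure μ → p ∘ₘ μ = μ → μ ≪ σ) {η : ℝ} (hη : 0 < η) :
    ∃ ε : ℝ, 0 < ε ∧ ∃ M : ℕ, ∀ m, M ≤ m → ∀ ν : Measure X, ∀ _ : IsProbabilityMeasure ν,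
      ∀ D, MeasurableSet D → σ.real D < ε → evalCA D (cesaro (markovCA p) m (ofMeasure ν)) ≤ η := by
  by_contra! hcon
  choose m hm ν hν D hD hσD hlarge using fun k : ℕ => hcon ((1 / 2) ^ k) (by positivity) (k + 1)
  choose α hα hαν using fun k => exists_cesaro_markovCA_ofMeasure p (ν k) (m := m k) (by
    have := hm k
    omega)
  have hmt : Tendsto m atTop atTop := tendsto_atTop_mono (fun k => (Nat.le_succ k).trans (hm k))
    tendsto_id
  obtain ⟨π, _, hπ, hlim⟩ := exists_invariant_limit p hstar α (by
    have h1 : Tendsto (fun k => 2 * ((m k : ℕ) : ℝ)⁻¹) atTop (𝓝 0) := by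
      simpa using ((tendsto_inv_atTop_nhds_zero_nat (𝕜 := ℝ)).comp hmt).const_mul 2
    refine squeeze_zero_norm (fun k => ?_) h1
    have h2 : markovCA p (ofMeasure (α k)) - ofMeasure (α k)
        = -((cesaro (markovCA p) (m k) * (1 - markovCA p)) (ofMeasure (ν k))) := by
      rw [mul_sub, mul_one, ← (commute_cesaro _ _).eq, _root_.sub_apply, mul_apply_eq_comp, hαν]
      abel
    rw [h2, norm_neg]
    refine (ContinuousLinearMap.le_of_opNorm_le _
      (norm_cesaro_mul_one_sub_le (norm_markovCA_le p) (m k)) _).trans ?_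
    rw [norm_ofMeasure, probReal_univ, mul_one])
  have hsum : ∑' k, σ (D k) ≠ ⊤ := by
    have h1 : Summable fun k : ℕ => ((1 : ℝ) / 2) ^ k := summable_geometric_two
    refine ne_top_of_le_ne_top h1.tsum_ofReal_ne_top (ENNReal.tsum_le_tsum fun k => ?_)
    rw [← ofReal_measureReal (by finiteness)]
    exact ENNReal.ofReal_le_ofReal (hσD k).le
  have hzero : π (limsup D atTop) = 0 := hσ π inferInstance hπ (measure_limsup_atTop_eq_zero hsum)
  let G : ℕ → Set X := fun k => ⋃ j ∈ {j | k ≤ j}, D j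
  have hG : ∀ k, MeasurableSet (G k) := fun k =>
    MeasurableSet.biUnion (Set.to_countable _) fun j _ => hD j
  have hanti : Antitone G := fun k l hkl =>
    Set.biUnion_subset_biUnion_left fun j (hj : l ≤ j) => hkl.trans hj
  have hπG : ∀ k, η ≤ π.real (G k) := by
    intro k
    refine ge_of_tendsto (hlim _ (hG k)) ?_
    filter_upwards [Nat.hyperfilter_le_atTop (eventually_ge_atTop k)] with j hj
    have h1 := (hlarge j).le
    rw [hαν, evalCA_ofMeasure _ (hD j)] at h1
    exact h1.trans (measureReal_mono (Set.subset_biUnion_of_mem (u := D) hj) (measure_ne_top _ _))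
  have h1 := tendsto_measure_iInter_atTop (μ := π) (fun k => (hG k).nullMeasurableSet) hanti
    ⟨0, measure_ne_top _ _⟩
  have h2 : ⋂ k, G k = limsup D atTop := by
    rw [limsup_eq_iInf_iSup_of_nat]
    rfl
  rw [h2, hzero] at h1
  have h3 := (ENNReal.tendsto_toReal ENNReal.zero_ne_top).comp h1
  have h4 : η ≤ (0 : ENNReal).toReal := ge_of_tendsto' h3 hπG
  rw [ENNReal.toReal_zero] at h4
  linarith

end Dominating

/-! ### Mean ergodicity on `ca` -/

section MeanErgodic

open FinAddMeasure

variable {X : Type*} [MeasurableSpace X]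

theorem ofMeasure_eq_zero_or_eq_smul (μ : Measure X) [IsFiniteMeasure μ] :
    ofMeasure μ = 0 ∨ ∃ (α : Measure X) (_ : IsProbabilityMeasure α),
      ofMeasure μ = μ.real Set.univ • ofMeasure α := by
  rcases eq_or_ne μ 0 with rfl | h
  · left
    refine ca_ext fun E hE => ?_
    rw [ofMeasure_apply _ hE]
    simp
  · right
    have : NeZero μ := ⟨h⟩
    refine ⟨(μ Set.univ)⁻¹ • μ, inferInstance, ca_ext fun E hE => ?_⟩
    change _ = μ.real Set.univ * (ofMeasure ((μ Set.univ)⁻¹ • μ)).1 E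
    rw [ofMeasure_apply _ hE, ofMeasure_apply _ hE, measureReal_ennreal_smul_apply,
      ENNReal.toReal_inv, ← measureReal_def, ← mul_assoc, mul_inv_cancel₀, one_mul]
    rw [Ne, measureReal_eq_zero_iff, Measure.measure_univ_eq_zero]
    exact h

variable (p : Kernel X X) [IsMarkovKernel p]

section L2

variable {σ : Measure X} [IsFiniteMeasure σ]

theorem integrable_of_L2 (u : Lp ℝ 2 σ) : Integrable u σ :=
  (Lp.memLp u).integrable one_le_two

/-- The bounded operator that sends a square integrable density to the measure with that density. -/
noncomputable def densityCA (σ : Measure X) [IsFiniteMeasure σ] : Lp ℝ 2 σ →L[ℝ] ca X :=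
  LinearMap.mkContinuous
    { toFun := fun u => ofDensity σ u (integrable_of_L2 u)
      map_add' := fun u v => ca_ext fun E hE => by
        change _ = (ofDensity σ u _).1 E + (ofDensity σ v _).1 E
        rw [ofDensity_apply _ _ hE, ofDensity_apply _ _ hE, ofDensity_apply _ _ hE,
          ← integral_add (integrable_of_L2 u).integrableOn (integrable_of_L2 v).integrableOn]
        exact integral_congr_ae (ae_restrict_of_ae (Lp.coeFn_add u v))
      map_smul' := fun c u => ca_ext fun E hE => by
        change _ = c * (ofDensity σ u _).1 E
        rw [ofDensity_apply _ _ hE, ofDensity_apply _ _ hE, ← integral_const_mul]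
        exact integral_congr_ae (ae_restrict_of_ae (Lp.coeFn_smul c u)) }
    (2 * σ.real Set.univ ^ (1 / (2 : ℝ)))
    fun u => by
      rw [mul_assoc]
      refine norm_le_two_mul _ (by positivity) fun E hE => ?_
      refine (congrArg abs (ofDensity_apply σ (integrable_of_L2 u) hE)).le.trans ?_
      rw [← L2.inner_indicatorConstLp_one (𝕜 := ℝ) hE (measure_ne_top σ E) u]
      refine (abs_real_inner_le_norm _ _).trans ?_
      gcongr
      rw [norm_indicatorConstLp two_ne_zero ENNReal.ofNat_ne_top, norm_one, one_mul,
        ENNReal.toReal_ofNat]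
      gcongr
      · exact measure_ne_top _ _
      · exact Set.subset_univ E

theorem densityCA_apply (u : Lp ℝ 2 σ) {E : Set X} (hE : MeasurableSet E) :
    (densityCA σ u).1 E = ∫ x in E, u x ∂σ := ofDensity_apply σ (integrable_of_L2 u) hE

theorem ofDensity_eq_densityCA {f : X → ℝ} (hf : Integrable f σ) (hf2 : MemLp f 2 σ) :
    ofDensity σ f hf = densityCA σ (hf2.toLp f) := by
  refine ca_ext fun E hE => ?_
  rw [ofDensity_apply _ _ hE, densityCA_apply _ hE]
  exact integral_congr_ae (ae_restrict_of_ae hf2.coeFn_toLp.symm)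

theorem measurePreserving_fst : MeasurePreserving Prod.fst (σ ⊗ₘ p) σ :=
  ⟨measurable_fst, Measure.fst_compProd σ p⟩

theorem measurePreserving_snd (hσ : p ∘ₘ σ = σ) : MeasurePreserving Prod.snd (σ ⊗ₘ p) σ :=
  ⟨measurable_snd, (Measure.snd_compProd σ p).trans hσ⟩

/-- The Markov operator on square integrable densities with respect to an invariant measure `σ`. If
`(x, y)` has the law `σ ⊗ₘ p` of one step of the stationary chain, it sends the density `u` to the
conditional expectation of `u x` given `y`: it is the composition with the first coordinate, followed
by the adjoint of the composition with the second one. -/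
noncomputable def markovL2 (hσ : p ∘ₘ σ = σ) : Lp ℝ 2 σ →L[ℝ] Lp ℝ 2 σ :=
  (ContinuousLinearMap.adjoint (Lp.compMeasurePreservingₗᵢ ℝ Prod.snd
      (measurePreserving_snd p hσ)).toContinuousLinearMap).comp
    (Lp.compMeasurePreservingₗᵢ ℝ Prod.fst (measurePreserving_fst p)).toContinuousLinearMap

theorem norm_markovL2_le (hσ : p ∘ₘ σ = σ) : ‖markovL2 p hσ‖ ≤ 1 := by
  refine (ContinuousLinearMap.opNorm_comp_le _ _).trans ?_
  refine mul_le_one₀ ?_ (norm_nonneg _) (LinearIsometry.norm_toContinuousLinearMap_le _)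
  rw [LinearIsometryEquiv.norm_map]
  exact LinearIsometry.norm_toContinuousLinearMap_le _

theorem markovCA_densityCA (hσ : p ∘ₘ σ = σ) (u : Lp ℝ 2 σ) :
    markovCA p (densityCA σ u) = densityCA σ (markovL2 p hσ u) := by
  refine ca_ext fun E hE => ?_
  have hE2 : MeasurableSet ((Prod.snd : X × X → X) ⁻¹' E) := measurable_snd hE
  rw [densityCA_apply _ hE, ← L2.inner_indicatorConstLp_one (𝕜 := ℝ) hE (measure_ne_top σ E),
    markovL2, ContinuousLinearMap.comp_apply, ContinuousLinearMap.adjoint_inner_right]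
  have e1 : (Lp.compMeasurePreservingₗᵢ ℝ Prod.snd (measurePreserving_snd p hσ))
      (indicatorConstLp 2 hE (measure_ne_top σ E) (1 : ℝ))
      = indicatorConstLp 2 hE2 (measure_ne_top (σ ⊗ₘ p) _) (1 : ℝ) :=
    Lp.indicatorConstLp_compMeasurePreserving hE (measure_ne_top σ E) 1
      (measurePreserving_snd p hσ)
  rw [LinearIsometry.coe_toContinuousLinearMap, LinearIsometry.coe_toContinuousLinearMap, e1,
    L2.inner_indicatorConstLp_one]
  have hu := integrable_of_L2 u
  have e2 : (Lp.compMeasurePreservingₗᵢ ℝ Prod.fst (measurePreserving_fst p) u : X × X → ℝ)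
      =ᵐ[σ ⊗ₘ p] u ∘ Prod.fst := Lp.coeFn_compMeasurePreserving u (measurePreserving_fst p)
  rw [integral_congr_ae (ae_restrict_of_ae e2)]
  have hint : Integrable (u ∘ Prod.fst) (σ ⊗ₘ p) :=
    ((measurePreserving_fst p).integrable_comp hu.aestronglyMeasurable).2 hu
  have e3 : (Prod.snd : X × X → X) ⁻¹' E = Set.univ ×ˢ E := by
    ext x
    simp
  rw [e3, Measure.setIntegral_compProd MeasurableSet.univ hE hint.integrableOn]
  rw [markovCA_coe, markovBA_apply p _ hE]
  refine (integral_ofDensity σ hu (measurable_transition p hE) (abs_transition_le p E)).trans ?_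
  simp

theorem cesaro_markovCA_densityCA (hσ : p ∘ₘ σ = σ) (n : ℕ) (u : Lp ℝ 2 σ) :
    cesaro (markovCA p) n (densityCA σ u) = densityCA σ (cesaro (markovL2 p hσ) n u) := by
  have hp : ∀ i : ℕ, (markovCA p ^ i) (densityCA σ u) = densityCA σ ((markovL2 p hσ ^ i) u) := by
    intro i
    induction i with
    | zero => rfl
    | succ i ih =>
      rw [pow_succ', pow_succ', mul_apply_eq_comp, mul_apply_eq_comp, ih, markovCA_densityCA]
  rw [cesaro, cesaro, _root_.smul_apply, _root_.smul_apply, _root_.sum_apply, _root_.sum_apply,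
    map_smul, map_sum]
  simp only [hp]

/-- Von Neumann's mean ergodic theorem for the averages that start with the first power. -/
theorem tendsto_cesaro_of_hilbert {H : Type*} [NormedAddCommGroup H] [InnerProductSpace ℝ H]
    [CompleteSpace H] {T : H →L[ℝ] H} (hT : ‖T‖ ≤ 1) (u : H) :
    ∃ w, Tendsto (fun n => cesaro T n u) atTop (𝓝 w) := by
  have h := (T.continuous.tendsto _).comp (T.tendsto_birkhoffAverage_orthogonalProjection hT u)
  refine ⟨_, h.congr fun n => ?_⟩
  have hp : ∀ i : ℕ, T ((T^[i]) u) = (T ^ (i + 1)) u := by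
    intro i
    rw [← Function.iterate_succ_apply' T i u]
    induction i with
    | zero => rfl
    | succ i ih => rw [Function.iterate_succ_apply', ih, pow_succ' T (i + 1), mul_apply_eq_comp]
  have hs : ∑ i ∈ Finset.range n, (T ^ (i + 1)) u = ∑ i ∈ Finset.Icc 1 n, (T ^ i) u := by
    rw [Finset.range_eq_Ico, Finset.sum_Ico_add' (fun i => (T ^ i) u) 0 n 1]
    rfl
  simp only [Function.comp_apply, birkhoffAverage, birkhoffSum, map_smul, map_sum, id, hp]
  rw [cesaro, _root_.smul_apply, _root_.sum_apply, hs]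

end L2

/-- Averages of absolutely continuous measures converge: their densities are approximated in the
mean by truncations, which are square integrable. -/
theorem tendsto_cesaro_of_absolutelyContinuous {σ : Measure X} [IsFiniteMeasure σ]
    (hσ : p ∘ₘ σ = σ) {α : Measure X} [IsFiniteMeasure α] (hα : α ≪ σ) :
    ∃ w, Tendsto (fun n => cesaro (markovCA p) n (ofMeasure α)) atTop (𝓝 w) := by
  set f : X → ℝ := fun x => (α.rnDeriv σ x).toReal with hf
  have hfm : Measurable f := (Measure.measurable_rnDeriv α σ).ennreal_toReal
  have hfi : Integrable f σ := Measure.integrable_toReal_rnDeriv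
  have hf0 : ∀ x, 0 ≤ f x := fun x => ENNReal.toReal_nonneg
  have e : ofMeasure α = ofDensity σ f hfi := by
    refine ca_ext fun E hE => ?_
    rw [ofMeasure_apply _ hE, ofDensity_apply _ _ hE, Measure.setIntegral_toReal_rnDeriv hα]
  have hgm : ∀ k : ℕ, Measurable fun x => min (f x) (k : ℝ) := fun k => hfm.min measurable_const
  have hgb : ∀ (k : ℕ) x, ‖min (f x) (k : ℝ)‖ ≤ k := fun k x => by
    rw [Real.norm_of_nonneg (le_min (hf0 x) (Nat.cast_nonneg k))]
    exact min_le_right _ _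
  have hg2 : ∀ k : ℕ, MemLp (fun x => min (f x) (k : ℝ)) 2 σ := fun k =>
    MemLp.of_bound (hgm k).aestronglyMeasurable k (Eventually.of_forall (hgb k))
  have hgi : ∀ k : ℕ, Integrable (fun x => min (f x) (k : ℝ)) σ := fun k =>
    (hg2 k).integrable one_le_two
  have hint : Tendsto (fun k : ℕ => ∫ x, ‖min (f x) (k : ℝ) - f x‖ ∂σ) atTop (𝓝 0) := by
    rw [← integral_zero X ℝ (μ := σ)]
    refine tendsto_integral_of_dominated_convergence f
      (fun k => ((hgm k).sub hfm).norm.aestronglyMeasurable) hfi (fun k => ?_) ?_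
    · refine Eventually.of_forall fun x => ?_
      rw [norm_norm, Real.norm_eq_abs, abs_le]
      have h1 : 0 ≤ min (f x) (k : ℝ) := le_min (hf0 x) (Nat.cast_nonneg k)
      have h2 : min (f x) (k : ℝ) ≤ f x := min_le_left _ _
      constructor <;> linarith [hf0 x]
    · refine Eventually.of_forall fun x => tendsto_const_nhds.congr' ?_
      obtain ⟨N, hN⟩ := exists_nat_ge (f x)
      filter_upwards [eventually_ge_atTop N] with k hk
      rw [min_eq_left (hN.trans (Nat.cast_le.2 hk)), sub_self, norm_zero]
  have hlim : Tendsto (fun k : ℕ => ofDensity σ _ (hgi k)) atTop (𝓝 (ofMeasure α)) := by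
    rw [e, tendsto_iff_norm_sub_tendsto_zero]
    refine squeeze_zero (fun _ => norm_nonneg _) (fun k => ?_) (by simpa using hint.const_mul 2)
    rw [ofDensity_sub]
    exact norm_ofDensity_le _ _
  refine (isClosed_setOf_tendsto_cesaro (norm_markovCA_le p)).mem_of_tendsto hlim
    (Eventually.of_forall fun k => ?_)
  obtain ⟨w, hw⟩ := tendsto_cesaro_of_hilbert (norm_markovL2_le p hσ) ((hg2 k).toLp _)
  refine ⟨densityCA σ w, ((densityCA σ).continuous.tendsto w |>.comp hw).congr fun n => ?_⟩
  rw [ofDensity_eq_densityCA (hgi k) (hg2 k), cesaro_markovCA_densityCA p hσ]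
  rfl

/-- The averages of every countably additive measure converge in total variation: the parts of the
averages that are singular to the dominating invariant measure live on one common null set, so their
mass tends to zero. -/
theorem tendsto_cesaro_markovCA (hstar : invProbBA p ⊆ (ca X : Set (FinAddMeasure X)))
    {σ : Measure X} [IsFiniteMeasure σ] (hσ : p ∘ₘ σ = σ)
    (hdom : ∀ μ : Measure X, IsProbabilityMeasure μ → p ∘ₘ μ = μ → μ ≪ σ) (ν : ca X) :
    ∃ w, Tendsto (fun n => cesaro (markovCA p) n ν) atTop (𝓝 w) := by
  have hprob : ∀ (ν : Measure X) (_ : IsProbabilityMeasure ν),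
      ∃ w, Tendsto (fun n => cesaro (markovCA p) n (ofMeasure ν)) atTop (𝓝 w) := by
    intro ν _
    choose α hα hαν using fun m : ℕ =>
      exists_cesaro_markovCA_ofMeasure p ν (m := m + 1) (Nat.succ_ne_zero m)
    choose S hS h1 h2 using fun m => Measure.mutuallySingular_singularPart (α m) σ
    set D := ⋃ m, (S m)ᶜ with hD
    have hDm : MeasurableSet D := MeasurableSet.iUnion fun m => (hS m).compl
    have hD0 : σ D = 0 := measure_iUnion_null h2
    have hac : ∀ m, (α m).restrict Dᶜ ≪ σ := by
      intro m
      refine Measure.AbsolutelyContinuous.mk fun N hN hN0 => ?_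
      rw [Measure.restrict_apply hN, Measure.haveLebesgueDecomposition_add (α m) σ,
        Measure.add_apply]
      have h3 : σ.withDensity ((α m).rnDeriv σ) (N ∩ Dᶜ) = 0 :=
        withDensity_absolutelyContinuous _ _ (measure_inter_null_of_null_left _ hN0)
      have h4 : (α m).singularPart σ (N ∩ Dᶜ) = 0 := by
        refine measure_mono_null (fun x hx => ?_) (h1 m)
        by_contra hxS
        exact hx.2 (Set.mem_iUnion.2 ⟨m, hxS⟩)
      rw [h3, h4, add_zero]
    change ofMeasure ν ∈ {v | ∃ w, Tendsto (fun n => cesaro (markovCA p) n v) atTop (𝓝 w)}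
    rw [← (isClosed_setOf_tendsto_cesaro (norm_markovCA_le p)).closure_eq,
      Metric.mem_closure_iff]
    intro η hη
    obtain ⟨ε, hε, M, hM⟩ := exists_uniform_absolutelyContinuous p hstar hdom (half_pos hη)
    have h5 := hM (M + 1) (Nat.le_succ M) ν inferInstance D hDm (by
      rw [measureReal_def, hD0]
      exact hε)
    rw [hαν, evalCA_ofMeasure _ hDm] at h5
    have hsplit : ofMeasure (α M) = ofMeasure ((α M).restrict Dᶜ) + ofMeasure ((α M).restrict D) := by
      rw [← ofMeasure_add]
      congr 1
      rw [add_comm, Measure.restrict_add_restrict_compl hDm]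
    -- `ν - A_m ν` is in the range of `1 - A`, where the averages tend to zero
    refine ⟨(ofMeasure ν - cesaro (markovCA p) (M + 1) (ofMeasure ν))
      + ofMeasure ((α M).restrict Dᶜ), tendsto_cesaro_add
        ⟨0, tendsto_cesaro_sub_cesaro (norm_markovCA_le p) (Nat.succ_ne_zero M) _⟩
        (tendsto_cesaro_of_absolutelyContinuous p hσ (hac M)), ?_⟩
    rw [dist_eq_norm, hαν, hsplit]
    have h6 : ofMeasure ν - (ofMeasure ν - (ofMeasure ((α M).restrict Dᶜ)
        + ofMeasure ((α M).restrict D)) + ofMeasure ((α M).restrict Dᶜ))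
        = ofMeasure ((α M).restrict D) := by abel
    rw [h6, norm_ofMeasure, measureReal_restrict_apply MeasurableSet.univ, Set.univ_inter]
    linarith
  have hfin : ∀ (μ : Measure X) (_ : IsFiniteMeasure μ),
      ∃ w, Tendsto (fun n => cesaro (markovCA p) n (ofMeasure μ)) atTop (𝓝 w) := by
    intro μ _
    rcases ofMeasure_eq_zero_or_eq_smul μ with h | ⟨α, hα, h⟩
    · rw [h]
      exact ⟨0, by simp⟩
    · rw [h]
      exact tendsto_cesaro_smul _ (hprob α hα)
  obtain ⟨μ₁, μ₂, _, _, -, -, -, -, rfl⟩ := exists_eq_ofMeasure_sub ν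
  rw [sub_eq_add_neg, ← neg_one_smul ℝ]
  exact tendsto_cesaro_add (hfin μ₁ inferInstance)
    (tendsto_cesaro_smul _ (hfin μ₂ inferInstance))

end MeanErgodic

/-! ### Operators given by signed kernels, and convergence in norm -/

section KernelOperators

open FinAddMeasure

variable {X : Type*} [MeasurableSpace X]

theorem integral_comp_eq (p : Kernel X X) [IsMarkovKernel p] (ν : Measure X)
    [IsProbabilityMeasure ν] {g : X → ℝ} (hg : Measurable g) {C : ℝ} (hC : ∀ x, ‖g x‖ ≤ C) :
    ∫ y, g y ∂(p ∘ₘ ν) = ∫ x, ∫ y, g y ∂(p x) ∂ν := by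
  rw [← Measure.snd_compProd, Measure.snd, integral_map measurable_snd.aemeasurable
    hg.aestronglyMeasurable]
  exact Measure.integral_compProd (f := fun z : X × X => g z.2)
    (Integrable.of_bound (hg.comp measurable_snd).aestronglyMeasurable C
      (Eventually.of_forall fun z => hC z.2))

/-- A bounded operator on `ca` that is given by a signed kernel, namely by its values at the point
masses. Not every bounded operator on `ca` is of this form. -/
def IsKernelOperator (R : ca X →L[ℝ] ca X) : Prop :=
  ∀ D, MeasurableSet D → (Measurable fun x => evalCA D (R (ofMeasure (Measure.dirac x)))) ∧
    ∀ ν : Measure X, ∀ _ : IsProbabilityMeasure ν,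
      evalCA D (R (ofMeasure ν)) = ∫ x, evalCA D (R (ofMeasure (Measure.dirac x))) ∂ν

theorem norm_evalCA_ofMeasure_le (R : ca X →L[ℝ] ca X) (D : Set X) (ν : Measure X)
    [IsProbabilityMeasure ν] : ‖evalCA D (R (ofMeasure ν))‖ ≤ ‖R‖ := by
  refine (abs_apply_le_norm (R (ofMeasure ν)).1 D).trans ?_
  refine (R.le_opNorm (ofMeasure ν)).trans ?_
  rw [norm_ofMeasure, probReal_univ, mul_one]

theorem IsKernelOperator.integrable {R : ca X →L[ℝ] ca X} (hR : IsKernelOperator R) {D : Set X}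
    (hD : MeasurableSet D) (ν : Measure X) [IsProbabilityMeasure ν] :
    Integrable (fun x => evalCA D (R (ofMeasure (Measure.dirac x)))) ν :=
  Integrable.of_bound (hR D hD).1.aestronglyMeasurable ‖R‖
    (Eventually.of_forall fun x => norm_evalCA_ofMeasure_le R D (Measure.dirac x))

theorem isKernelOperator_one : IsKernelOperator (1 : ca X →L[ℝ] ca X) := by
  intro D hD
  have e : ∀ x, evalCA D ((1 : ca X →L[ℝ] ca X) (ofMeasure (Measure.dirac x)))
      = D.indicator (fun _ => (1 : ℝ)) x := fun x => by
    rw [one_apply_eq_self, evalCA_ofMeasure _ hD, measureReal_def, Measure.dirac_apply' _ hD]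
    by_cases hx : x ∈ D <;> simp [hx]
  simp only [e]
  refine ⟨measurable_const.indicator hD, fun ν _ => ?_⟩
  rw [one_apply_eq_self, evalCA_ofMeasure _ hD, integral_indicator hD]
  simp

theorem IsKernelOperator.mul_markovCA {R : ca X →L[ℝ] ca X} (hR : IsKernelOperator R)
    (p : Kernel X X) [IsMarkovKernel p] : IsKernelOperator (R * markovCA p) := by
  intro D hD
  have e : ∀ x, evalCA D ((R * markovCA p) (ofMeasure (Measure.dirac x)))
      = ∫ y, evalCA D (R (ofMeasure (Measure.dirac y))) ∂(p x) := fun x => by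
    rw [mul_apply_eq_comp, markovCA_ofMeasure, (hR D hD).2 _ inferInstance,
      Measure.dirac_bind p.measurable]
  simp only [e]
  refine ⟨((hR D hD).1.stronglyMeasurable.integral_kernel).measurable, fun ν _ => ?_⟩
  rw [mul_apply_eq_comp, markovCA_ofMeasure, (hR D hD).2 _ inferInstance]
  exact integral_comp_eq p ν (hR D hD).1
    (fun x => norm_evalCA_ofMeasure_le R D (Measure.dirac x))

theorem IsKernelOperator.smul {R : ca X →L[ℝ] ca X} (hR : IsKernelOperator R) (c : ℝ) :
    IsKernelOperator (c • R) := by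
  intro D hD
  simp only [_root_.smul_apply, map_smul, smul_eq_mul]
  refine ⟨(hR D hD).1.const_mul c, fun ν _ => ?_⟩
  rw [(hR D hD).2 ν inferInstance, integral_const_mul]

theorem IsKernelOperator.add {R Q : ca X →L[ℝ] ca X} (hR : IsKernelOperator R)
    (hQ : IsKernelOperator Q) : IsKernelOperator (R + Q) := by
  intro D hD
  simp only [_root_.add_apply, map_add]
  refine ⟨(hR D hD).1.add (hQ D hD).1, fun ν _ => ?_⟩
  rw [(hR D hD).2 ν inferInstance, (hQ D hD).2 ν inferInstance,
    integral_add (hR.integrable hD ν) (hQ.integrable hD ν)]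

theorem isKernelOperator_cesaro (p : Kernel X X) [IsMarkovKernel p] (m : ℕ) :
    IsKernelOperator (cesaro (markovCA p) m) := by
  have hpow : ∀ i : ℕ, IsKernelOperator (markovCA p ^ i) := by
    intro i
    induction i with
    | zero => exact isKernelOperator_one
    | succ i ih => exact pow_succ (markovCA p) i ▸ ih.mul_markovCA p
  refine IsKernelOperator.smul ?_ _
  refine Finset.sum_induction _ IsKernelOperator (fun _ _ h h' => h.add h') ?_ fun i _ => hpow i
  exact zero_smul ℝ (1 : ca X →L[ℝ] ca X) ▸ isKernelOperator_one.smul 0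

/-- Strong limits of averages are again given by kernels. -/
theorem isKernelOperator_of_tendsto (p : Kernel X X) [IsMarkovKernel p] {E : ca X →L[ℝ] ca X}
    (hE : ∀ v, Tendsto (fun n => cesaro (markovCA p) n v) atTop (𝓝 (E v))) :
    IsKernelOperator E := by
  intro D hD
  have hlim : ∀ v, Tendsto (fun n => evalCA D (cesaro (markovCA p) n v)) atTop
      (𝓝 (evalCA D (E v))) := fun v => ((evalCA D).continuous.tendsto _).comp (hE v)
  have hK := fun n => isKernelOperator_cesaro p n D hD
  refine ⟨measurable_of_tendsto_metrizable (fun n => (hK n).1)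
    (tendsto_pi_nhds.2 fun x => hlim _), fun ν _ => ?_⟩
  refine tendsto_nhds_unique (hlim (ofMeasure ν)) ?_
  simp only [(hK _).2 ν inferInstance]
  refine tendsto_integral_of_dominated_convergence (fun _ => 1)
    (fun n => (hK n).1.aestronglyMeasurable) (integrable_const 1) (fun n => ?_)
    (Eventually.of_forall fun x => hlim _)
  exact Eventually.of_forall fun x =>
    (norm_evalCA_ofMeasure_le _ D (Measure.dirac x)).trans (norm_cesaro_le (norm_markovCA_le p) n)

theorem opNorm_le_of_probability (R : ca X →L[ℝ] ca X) {C : ℝ} (hC : 0 ≤ C)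
    (h : ∀ ν : Measure X, ∀ _ : IsProbabilityMeasure ν, ‖R (ofMeasure ν)‖ ≤ C) : ‖R‖ ≤ C := by
  have hfin : ∀ μ : Measure X, ∀ _ : IsFiniteMeasure μ,
      ‖R (ofMeasure μ)‖ ≤ C * μ.real Set.univ := by
    intro μ _
    rcases ofMeasure_eq_zero_or_eq_smul μ with e | ⟨α, hα, e⟩
    · rw [e, map_zero, norm_zero]
      exact mul_nonneg hC measureReal_nonneg
    · rw [e, map_smul, norm_smul, Real.norm_of_nonneg measureReal_nonneg, mul_comm]
      gcongr
      exact h α hα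
  refine R.opNorm_le_bound hC fun ν => ?_
  obtain ⟨μ₁, μ₂, _, _, H, hH, h1, h2, rfl⟩ := exists_eq_ofMeasure_sub ν
  rw [norm_ofMeasure_sub hH h1 h2, map_sub, mul_add]
  exact (norm_sub_le _ _).trans (add_le_add (hfin μ₁ inferInstance) (hfin μ₂ inferInstance))

variable (p : Kernel X X) [IsMarkovKernel p]

/-- The kernels `x ↦ (cesaro A m - E) δ_x` tend to zero in measure, uniformly over the sets `D` at which
they are evaluated: for any choice of sets the values tend to zero at every point, since `δ_x` is in
`ca`. -/
theorem exists_measureReal_kernel_lt (σ : Measure X) [IsFiniteMeasure σ] {E : ca X →L[ℝ] ca X}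
    (hE : ∀ v, Tendsto (fun n => cesaro (markovCA p) n v) atTop (𝓝 (E v))) {δ ε : ℝ} (hδ : 0 < δ)
    (hε : 0 < ε) (M : ℕ) : ∃ m, M ≤ m ∧ ∀ D, MeasurableSet D → σ.real
      {x | δ ≤ ‖evalCA D ((cesaro (markovCA p) m - E) (ofMeasure (Measure.dirac x)))‖} < ε := by
  by_contra! hcon
  choose D hD hlarge using fun k : ℕ => hcon (k + M) (Nat.le_add_left M k)
  have hK : ∀ k, IsKernelOperator (cesaro (markovCA p) (k + M) - E) := fun k => by
    rw [sub_eq_add_neg, ← neg_one_smul ℝ E]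
    exact (isKernelOperator_cesaro p _).add ((isKernelOperator_of_tendsto p hE).smul _)
  have h1 : TendstoInMeasure σ (fun k x => evalCA (D k)
      ((cesaro (markovCA p) (k + M) - E) (ofMeasure (Measure.dirac x)))) atTop fun _ => 0 := by
    refine tendstoInMeasure_of_tendsto_ae (fun k => (hK k (D k) (hD k)).1.aestronglyMeasurable)
      (Eventually.of_forall fun x => ?_)
    have h2 := ((tendsto_add_atTop_iff_nat M).2 (hE (ofMeasure (Measure.dirac x))))
    rw [tendsto_iff_norm_sub_tendsto_zero] at h2
    refine squeeze_zero_norm (fun k => ?_) h2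
    rw [_root_.sub_apply]
    exact abs_apply_le_norm (cesaro (markovCA p) (k + M) (ofMeasure (Measure.dirac x))
      - E (ofMeasure (Measure.dirac x))).1 (D k)
  have h3 := tendstoInMeasure_iff_measureReal_norm.1 h1 δ hδ
  simp only [sub_zero] at h3
  obtain ⟨k, hk⟩ := (h3.eventually_lt_const hε).exists
  exact absurd hk (not_lt.2 (hlarge k))

/-- Where the kernel of `cesaro A m - E` is not small, the averages have little mass. So the square
of the difference is small in norm. -/
theorem exists_norm_mul_self_lt_one (hstar : invProbBA p ⊆ (ca X : Set (FinAddMeasure X)))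
    {σ : Measure X} [IsFiniteMeasure σ]
    (hdom : ∀ μ : Measure X, IsProbabilityMeasure μ → p ∘ₘ μ = μ → μ ≪ σ) {E : ca X →L[ℝ] ca X}
    (hE : ∀ v, Tendsto (fun n => cesaro (markovCA p) n v) atTop (𝓝 (E v)))
    (hAE : markovCA p * E = E) (hEE : E * E = E) :
    ∃ m, m ≠ 0 ∧ ‖(cesaro (markovCA p) m - E) * (cesaro (markovCA p) m - E)‖ < 1 := by
  obtain ⟨ε, hε, M, hM⟩ := exists_uniform_absolutelyContinuous p hstar hdom
    (η := 1 / 32) (by norm_num)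
  obtain ⟨m, hm, hmD⟩ := exists_measureReal_kernel_lt p σ hE (δ := 1 / 16) (by norm_num) hε (M + 1)
  have hm0 : m ≠ 0 := by omega
  refine ⟨m, hm0, lt_of_le_of_lt ?_ (show (1 / 4 : ℝ) < 1 by norm_num)⟩
  set S := cesaro (markovCA p) m - E with hS
  have hSE : S * E = 0 := by
    ext1 v
    have h1 : markovCA p (E v) = E v := DFunLike.congr_fun hAE v
    have h2 : E (E v) = E v := DFunLike.congr_fun hEE v
    rw [hS, mul_apply_eq_comp, _root_.sub_apply, cesaro_apply_of_fixed h1 hm0, h2, sub_self]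
    rfl
  -- since `S * E = 0`, the outer factor only has to be applied to the probability measure `A_m ν`
  have hSS : S * S = S * cesaro (markovCA p) m := by
    conv_lhs => rw [hS, mul_sub, ← hS, hSE, sub_zero]
  have hSK : IsKernelOperator S := by
    rw [hS, sub_eq_add_neg, ← neg_one_smul ℝ E]
    exact (isKernelOperator_cesaro p _).add ((isKernelOperator_of_tendsto p hE).smul _)
  have hEn : ‖E‖ ≤ 1 := by
    refine E.opNorm_le_bound zero_le_one fun v => ?_
    exact le_of_tendsto (hE v).norm (Eventually.of_forall fun n =>
      (cesaro (markovCA p) n).le_of_opNorm_le (norm_cesaro_le (norm_markovCA_le p) n) v)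
  have hSn : ‖S‖ ≤ 2 := by
    have := norm_sub_le (cesaro (markovCA p) m) E
    linarith [norm_cesaro_le (norm_markovCA_le p) m]
  refine opNorm_le_of_probability _ (by norm_num) fun ν _ => ?_
  obtain ⟨α, _, hα⟩ := exists_cesaro_markovCA_ofMeasure p ν hm0
  rw [hSS, mul_apply_eq_comp, hα]
  refine (norm_le_two_mul _ (C := 1 / 8) (by norm_num) fun D hD => ?_).trans (by norm_num)
  set h : X → ℝ := fun x => evalCA D (S (ofMeasure (Measure.dirac x))) with hh
  have hhm : Measurable h := (hSK D hD).1
  set F : Set X := {x | 1 / 16 ≤ ‖h x‖} with hF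
  have hFm : MeasurableSet F := measurableSet_le measurable_const hhm.norm
  have hαF : α.real F ≤ 1 / 32 := by
    rw [← evalCA_ofMeasure α hFm, ← hα]
    exact hM m (by omega) ν inferInstance F hFm (hmD D hD)
  have hval : (S (ofMeasure α)).1 D = ∫ x, h x ∂α := (hSK D hD).2 α inferInstance
  refine (congrArg abs hval).le.trans ?_
  calc |∫ x, h x ∂α| ≤ ∫ x, (1 / 16 + F.indicator (fun _ => (2 : ℝ)) x) ∂α := by
        have hi : Integrable (fun x => 1 / 16 + F.indicator (fun _ => (2 : ℝ)) x) α :=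
          (integrable_const _).add ((integrable_const _).indicator hFm)
        rw [← Real.norm_eq_abs]
        refine norm_integral_le_of_norm_le hi (Eventually.of_forall fun x => ?_)
        by_cases hx : x ∈ F
        · rw [Set.indicator_of_mem hx]
          have := (norm_evalCA_ofMeasure_le S D (Measure.dirac x)).trans hSn
          change ‖h x‖ ≤ 2 at this
          linarith
        · rw [Set.indicator_of_notMem hx, add_zero]
          exact (not_le.1 hx).le
    _ = 1 / 16 + 2 * α.real F := by
        rw [integral_add (integrable_const _) ((integrable_const _).indicator hFm),
          integral_indicator hFm]
        simp [mul_comm]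
    _ ≤ 1 / 8 := by linarith

end KernelOperators

/-! ### Finite dimension of the space of invariant measures -/

section FiniteDimension

open FinAddMeasure

variable {X : Type*} [MeasurableSpace X]

/-- A space of square integrable functions whose supremum norm is bounded by `K` times the `L²` norm
has finite dimension: if `g₁, …, g_N` is an orthonormal family in it, then `∑ gᵢ(x)² ≤ K²` for
almost every `x`, and integration gives `N ≤ K² σ(X)`. -/
theorem finiteDimensional_of_ae_abs_le {σ : Measure X} [IsFiniteMeasure σ]
    (H : Submodule ℝ (Lp ℝ 2 σ)) (K : ℝ) (hH : ∀ u ∈ H, ∀ᵐ x ∂σ, |u x| ≤ K * ‖u‖) :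
    FiniteDimensional ℝ H := by
  have hr : Module.rank ℝ H ≤ (⌈K ^ 2 * σ.real Set.univ⌉₊ : ℕ) := by
    refine rank_le fun s hs => ?_
    set W := Submodule.span ℝ (s : Set H) with hW
    have hfr : Module.finrank ℝ W = s.card := finrank_span_finset_eq_card hs
    let b := stdOrthonormalBasis ℝ W
    rw [← hfr]
    set N := Module.finrank ℝ W
    let g : Fin N → Lp ℝ 2 σ := fun i => ((b i : W) : H)
    have hg : Orthonormal ℝ g :=
      (b.orthonormal.comp_linearIsometry W.subtypeₗᵢ).comp_linearIsometry H.subtypeₗᵢ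
    have hgH : ∀ i, g i ∈ H := fun i => ((b i : W) : H).2
    -- the bound for countably many coefficient vectors holds at almost every point at once
    have hae : ∀ᵐ x ∂σ, ∀ a : Fin N → ℚ,
        (∑ i, (a i : ℝ) * g i x) ^ 2 ≤ K ^ 2 * ∑ i, (a i : ℝ) ^ 2 := by
      refine ae_all_iff.2 fun a => ?_
      have hmem : ∑ i, (a i : ℝ) • g i ∈ H :=
        H.sum_mem fun i _ => H.smul_mem _ (hgH i)
      have hcoe : (∑ i, (a i : ℝ) • g i : Lp ℝ 2 σ) =ᵐ[σ] fun x => ∑ i, (a i : ℝ) * g i x := by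
        have h1 := Lp.coeFn_finsetSum (μ := σ) (p := 2) Finset.univ fun i => (a i : ℝ) • g i
        have h2 : ∀ᵐ x ∂σ, ∀ i, ((a i : ℝ) • g i : Lp ℝ 2 σ) x = (a i : ℝ) * g i x :=
          ae_all_iff.2 fun i => Lp.coeFn_smul (a i : ℝ) (g i)
        filter_upwards [h1, h2] with x h1 h2
        rw [h1, Finset.sum_apply]
        exact Finset.sum_congr rfl fun i _ => h2 i
      have hnorm : ‖∑ i, (a i : ℝ) • g i‖ ^ 2 = ∑ i, (a i : ℝ) ^ 2 := by
        rw [← real_inner_self_eq_norm_sq, hg.inner_sum]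
        exact Finset.sum_congr rfl fun i _ => by simp [sq]
      filter_upwards [hH _ hmem, hcoe] with x h1 h2
      rw [h2] at h1
      rw [← hnorm, ← mul_pow, ← sq_abs]
      exact pow_le_pow_left₀ (abs_nonneg _) h1 2
    have hpt : ∀ᵐ x ∂σ, ∑ i, g i x ^ 2 ≤ K ^ 2 := by
      filter_upwards [hae] with x hx
      have hd : DenseRange fun (a : Fin N → ℚ) (i : Fin N) => ((a i : ℚ) : ℝ) :=
        DenseRange.piMap fun _ => Rat.denseRange_cast
      have hreal : ∀ c : Fin N → ℝ, (∑ i, c i * g i x) ^ 2 ≤ K ^ 2 * ∑ i, c i ^ 2 := fun c => by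
        refine hd.induction_on c (isClosed_le (by fun_prop) (by fun_prop)) hx
      have h1 := hreal fun i => g i x
      simp only [← sq] at h1
      have h0 : 0 ≤ ∑ i, g i x ^ 2 := Finset.sum_nonneg fun i _ => sq_nonneg _
      rcases h0.eq_or_lt with h2 | h2
      · rw [← h2]
        positivity
      · rw [sq (∑ i, g i x ^ 2)] at h1
        exact le_of_mul_le_mul_right h1 h2
    have hsq : ∀ i, Integrable (fun x => g i x ^ 2) σ := fun i => (Lp.memLp (g i)).integrable_sq
    have hone : ∀ i, ∫ x, g i x ^ 2 ∂σ = 1 := by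
      intro i
      have h1 := hg.1 i
      have h2 : inner ℝ (g i) (g i) = (1 : ℝ) := by
        rw [real_inner_self_eq_norm_sq, h1, one_pow]
      rw [L2.inner_def] at h2
      rw [← h2]
      exact integral_congr_ae (Eventually.of_forall fun x => by simp [sq])
    have hint : ∫ x, ∑ i, g i x ^ 2 ∂σ = N := by
      rw [integral_finsetSum _ fun i _ => hsq i]
      simp [hone]
    have hle : (N : ℝ) ≤ K ^ 2 * σ.real Set.univ := by
      rw [← hint]
      calc ∫ x, ∑ i, g i x ^ 2 ∂σ ≤ ∫ _, K ^ 2 ∂σ :=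
            integral_mono_ae (integrable_finsetSum _ fun i _ => hsq i) (integrable_const _) hpt
        _ = K ^ 2 * σ.real Set.univ := by simp [mul_comm]
    exact_mod_cast hle.trans (Nat.le_ceil _)
  exact Module.rank_lt_aleph0_iff.1 (lt_of_le_of_lt hr (Cardinal.natCast_lt_aleph0))

variable (p : Kernel X X) [IsMarkovKernel p]

/-- Invariant measures are bounded by a fixed multiple of the dominating invariant measure `σ`: the
positive part of `μ - c σ` is invariant, and for large `c` it lives on a set of small `σ`-measure, on
which no invariant probability can be concentrated. -/
theorem exists_forall_invariant_le (hstar : invProbBA p ⊆ (ca X : Set (FinAddMeasure X)))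
    {σ : Measure X} [IsFiniteMeasure σ] (hσ : p ∘ₘ σ = σ)
    (hdom : ∀ μ : Measure X, IsProbabilityMeasure μ → p ∘ₘ μ = μ → μ ≪ σ) :
    ∃ C : ℝ, 0 ≤ C ∧ ∀ μ : Measure X, ∀ _ : IsFiniteMeasure μ, p ∘ₘ μ = μ →
      ∀ E, MeasurableSet E → μ.real E ≤ C * μ.real Set.univ * σ.real E := by
  obtain ⟨ε, hε, M, hM⟩ := exists_uniform_absolutelyContinuous p hstar hdom
    (η := 1 / 2) (by norm_num)
  refine ⟨2 / ε, by positivity, fun μ _ hμ E hE => ?_⟩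
  set a := μ.real Set.univ with ha
  have ha0 : 0 ≤ a := measureReal_nonneg
  obtain ⟨μ₁, μ₂, _, _, H, hH, h1, h2, e⟩ :=
    exists_eq_ofMeasure_sub (ofMeasure μ - (2 / ε * a) • ofMeasure σ)
  have hval : ∀ E, MeasurableSet E → μ.real E - 2 / ε * a * σ.real E = μ₁.real E - μ₂.real E :=
    fun E hE => by
      have := congrArg (evalCA E) e
      rwa [map_sub, map_sub, map_smul, evalCA_ofMeasure _ hE, evalCA_ofMeasure _ hE,
        evalCA_ofMeasure _ hE, evalCA_ofMeasure _ hE, smul_eq_mul] at this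
  have hinv : markovCA p (ofMeasure μ₁ - ofMeasure μ₂) = ofMeasure μ₁ - ofMeasure μ₂ := by
    rw [← e, map_sub, map_smul, (markovCA_ofMeasure_eq_iff p μ).2 hμ,
      (markovCA_ofMeasure_eq_iff p σ).2 hσ]
  obtain ⟨hi, -⟩ := comp_eq_of_ofMeasure_sub p hH h1 h2 hinv
  have hμ₁ : μ₁ = 0 := by
    -- otherwise the normalization of `μ₁` is an invariant probability concentrated on `H`
    by_contra hne
    have : NeZero μ₁ := ⟨hne⟩
    have hHpos : 0 < μ₁.real H := by
      refine lt_of_le_of_ne measureReal_nonneg fun h0 => hne ?_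
      rw [← Measure.measure_univ_eq_zero, ← Set.union_compl_self H]
      exact measure_union_null ((measureReal_eq_zero_iff (measure_ne_top _ _)).1 h0.symm) h1
    have hvH := hval H hH
    rw [measureReal_def μ₂, h2, ENNReal.toReal_zero, sub_zero] at hvH
    have hμH : μ.real H ≤ a := measureReal_mono (Set.subset_univ H) (measure_ne_top _ _)
    have hσH0 : 0 ≤ σ.real H := measureReal_nonneg
    have hapos : 0 < a := by
      have : 0 ≤ 2 / ε * a * σ.real H := by positivity
      linarith
    have hσH : σ.real H < ε := by
      have h3 : 2 / ε * a * σ.real H < a := by linarith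
      have h4 : 2 / ε * σ.real H < 1 := by
        by_contra! h5
        nlinarith
      rw [div_mul_eq_mul_div, div_lt_one hε] at h4
      linarith
    set α := (μ₁ Set.univ)⁻¹ • μ₁ with hα
    have hαi : p ∘ₘ α = α := by rw [hα, Measure.comp_smul, hi]
    have h6 := hM (M + 1) (Nat.le_succ M) α inferInstance H hH hσH
    rw [cesaro_apply_of_fixed ((markovCA_ofMeasure_eq_iff p α).2 hαi) (Nat.succ_ne_zero M),
      evalCA_ofMeasure _ hH, measureReal_def, (prob_compl_eq_zero_iff hH).1] at h6
    · norm_num at h6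
    · rw [hα, Measure.smul_apply, h1, smul_zero]
  have h7 := hval E hE
  rw [hμ₁] at h7
  have h8 : 0 ≤ μ₂.real E := measureReal_nonneg
  simp only [measureReal_zero, Pi.zero_apply] at h7
  linarith

theorem exists_ofMeasure_eq_densityCA {σ μ : Measure X} [IsFiniteMeasure σ] [IsFiniteMeasure μ]
    {K : ℝ} (h : ∀ E, MeasurableSet E → μ.real E ≤ K * σ.real E) :
    ∃ u : Lp ℝ 2 σ, ofMeasure μ = densityCA σ u := by
  have hac : μ ≪ σ := by
    refine Measure.AbsolutelyContinuous.mk fun N hN hN0 => ?_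
    have h1 := h N hN
    rw [measureReal_def σ, hN0, ENNReal.toReal_zero, mul_zero] at h1
    exact (measureReal_eq_zero_iff (measure_ne_top _ _)).1 (le_antisymm h1 measureReal_nonneg)
  have hfi : Integrable (fun x => (μ.rnDeriv σ x).toReal) σ := Measure.integrable_toReal_rnDeriv
  have hset : ∀ E, ∫ x in E, (μ.rnDeriv σ x).toReal ∂σ = μ.real E := fun E =>
    Measure.setIntegral_toReal_rnDeriv hac E
  have hb : ∀ᵐ x ∂σ, (μ.rnDeriv σ x).toReal ≤ K := by
    refine ae_le_of_forall_setIntegral_le hfi (integrable_const K) fun E hE _ => ?_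
    rw [hset]
    refine (h E hE).trans (le_of_eq ?_)
    simp [mul_comm]
  have h2 : MemLp (fun x => (μ.rnDeriv σ x).toReal) 2 σ := by
    refine MemLp.of_bound hfi.aestronglyMeasurable K ?_
    filter_upwards [hb] with x hx
    rwa [Real.norm_of_nonneg ENNReal.toReal_nonneg]
  refine ⟨h2.toLp _, ?_⟩
  rw [← ofDensity_eq_densityCA hfi h2]
  refine ca_ext fun E hE => ?_
  rw [ofMeasure_apply _ hE, ofDensity_apply _ _ hE, hset]

theorem finiteDimensional_invCA (hstar : invProbBA p ⊆ (ca X : Set (FinAddMeasure X)))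
    {σ : Measure X} [IsFiniteMeasure σ] (hσ : p ∘ₘ σ = σ)
    (hdom : ∀ μ : Measure X, IsProbabilityMeasure μ → p ∘ₘ μ = μ → μ ≪ σ) :
    FiniteDimensional ℝ (invCA p) := by
  obtain ⟨C, hC0, hC⟩ := exists_forall_invariant_le p hstar hσ hdom
  have hbound : ∀ ν ∈ invCA p, (∃ u, densityCA σ u = ν) ∧
      ∀ E, MeasurableSet E → |evalCA E ν| ≤ C * ‖ν‖ * σ.real E := by
    intro ν hν
    obtain ⟨μ₁, μ₂, _, _, H, hH, h1, h2, rfl⟩ := exists_eq_ofMeasure_sub ν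
    obtain ⟨hi1, hi2⟩ := comp_eq_of_ofMeasure_sub p hH h1 h2 hν
    have hb1 := hC μ₁ inferInstance hi1
    have hb2 := hC μ₂ inferInstance hi2
    refine ⟨?_, fun E hE => ?_⟩
    · obtain ⟨u₁, hu₁⟩ := exists_ofMeasure_eq_densityCA hb1
      obtain ⟨u₂, hu₂⟩ := exists_ofMeasure_eq_densityCA hb2
      exact ⟨u₁ - u₂, by rw [map_sub, hu₁, hu₂]⟩
    · rw [norm_ofMeasure_sub hH h1 h2, map_sub, evalCA_ofMeasure _ hE, evalCA_ofMeasure _ hE,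
        mul_add, add_mul]
      have := hb1 E hE
      have := hb2 E hE
      have : 0 ≤ μ₁.real E := measureReal_nonneg
      have : 0 ≤ μ₂.real E := measureReal_nonneg
      rw [abs_le]
      constructor <;> linarith
  set W := (invCA p).comap (densityCA σ).toLinearMap with hW
  have hWfin : FiniteDimensional ℝ W := by
    refine finiteDimensional_of_ae_abs_le W (C * ‖densityCA σ‖) fun u hu => ?_
    have h1 : ∀ E, MeasurableSet E →
        |∫ x in E, u x ∂σ| ≤ C * ‖densityCA σ‖ * ‖u‖ * σ.real E := by
      intro E hE
      rw [← densityCA_apply u hE]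
      refine ((hbound _ hu).2 E hE).trans ?_
      rw [mul_assoc C ‖densityCA σ‖]
      gcongr
      exact (densityCA σ).le_opNorm u
    have h2 : u ≤ᵐ[σ] fun _ => C * ‖densityCA σ‖ * ‖u‖ := by
      refine ae_le_of_forall_setIntegral_le (integrable_of_L2 u) (integrable_const _)
        fun E hE _ => ((le_abs_self _).trans (h1 E hE)).trans (le_of_eq ?_)
      simp [mul_comm]
    have h3 : (fun x => -(u x)) ≤ᵐ[σ] fun _ => C * ‖densityCA σ‖ * ‖u‖ := by
      refine ae_le_of_forall_setIntegral_le (integrable_of_L2 u).neg (integrable_const _)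
        fun E hE _ => ?_
      rw [integral_neg]
      refine ((neg_le_abs _).trans (h1 E hE)).trans (le_of_eq ?_)
      simp [mul_comm]
    filter_upwards [h2, h3] with x h2 h3
    exact abs_le.2 ⟨by linarith, h2⟩
  have hle : invCA p ≤ W.map (densityCA σ).toLinearMap := by
    intro ν hν
    obtain ⟨u, hu⟩ := (hbound ν hν).1
    refine ⟨u, ?_, hu⟩
    change densityCA σ u ∈ invCA p
    rwa [hu]
  exact Submodule.finiteDimensional_of_le hle

/-- By the Jordan decomposition, invariant probability measures span all invariant measures. -/
theorem span_invProbCA :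
    Submodule.span ℝ (invProbCA p) = (invCA p).map (ca X).subtype := by
  refine le_antisymm (Submodule.span_le.2 ?_) ?_
  · rintro μ ⟨hca, -, -, hinv⟩
    exact ⟨⟨μ, hca⟩, Subtype.ext hinv, rfl⟩
  · rintro _ ⟨ν, hν, rfl⟩
    have hpos : ∀ μ : Measure X, ∀ _ : IsFiniteMeasure μ, p ∘ₘ μ = μ →
        (ofMeasure μ : FinAddMeasure X) ∈ Submodule.span ℝ (invProbCA p) := by
      intro μ _ hμ
      rcases eq_or_ne μ 0 with rfl | hne
      · have h0 : ofMeasure (0 : Measure X) = 0 := ca_ext fun E hE => by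
          rw [ofMeasure_apply _ hE]
          simp
        rw [h0]
        exact Submodule.zero_mem _
      · have : NeZero μ := ⟨hne⟩
        have hα : p ∘ₘ ((μ Set.univ)⁻¹ • μ) = (μ Set.univ)⁻¹ • μ := by rw [Measure.comp_smul, hμ]
        obtain ⟨hn, h1, hi⟩ := ofMeasure_mem_invProbBA p _ hα
        have hmem := Submodule.smul_mem _ (μ.real Set.univ) (Submodule.subset_span
          (show _ ∈ invProbCA p from ⟨(ofMeasure ((μ Set.univ)⁻¹ • μ)).2, hn, h1, hi⟩))
        convert hmem using 1
        refine FinAddMeasure.ext fun E hE => ?_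
        rw [FinAddMeasure.smul_apply, ofMeasure_apply _ hE, ofMeasure_apply _ hE,
          measureReal_ennreal_smul_apply, ENNReal.toReal_inv, ← measureReal_def, ← mul_assoc,
          mul_inv_cancel₀, one_mul]
        rw [Ne, measureReal_eq_zero_iff, Measure.measure_univ_eq_zero]
        exact hne
    obtain ⟨μ₁, μ₂, _, _, H, hH, h1, h2, rfl⟩ := exists_eq_ofMeasure_sub ν
    obtain ⟨hi1, hi2⟩ := comp_eq_of_ofMeasure_sub p hH h1 h2 hν
    exact Submodule.sub_mem _ (hpos μ₁ inferInstance hi1) (hpos μ₂ inferInstance hi2)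

end FiniteDimension

theorem theorem4p5 {X : Type*} [MeasurableSpace X] (p : Kernel X X) [IsMarkovKernel p]
    (hstar : invProbBA p ⊆ (FinAddMeasure.ca X : Set (FinAddMeasure X))) :
    (∃ n : ℕ,
      Module.rank ℝ (invCA p) = n ∧
      Module.rank ℝ (Submodule.span ℝ (invProbBA p)) = n ∧
      Module.rank ℝ (Submodule.span ℝ (invProbCA p)) = n) ∧
    ∃ E : FinAddMeasure.ca X →L[ℝ] FinAddMeasure.ca X,
      IsSpectralProjection (markovCA p) 1 E ∧
      Set.range E = (invCA p : Set (FinAddMeasure.ca X)) ∧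
      Tendsto (fun n : ℕ => (n : ℝ)⁻¹ • ∑ i ∈ Finset.Icc 1 n, markovCA p ^ i) atTop (𝓝 E) := by
  obtain ⟨σ, _, hσ, hdom⟩ := exists_dominating_invariant p hstar
  constructor
  · have := finiteDimensional_invCA p hstar hσ hdom
    have h1 : Module.rank ℝ (invCA p) = (Module.finrank ℝ (invCA p) : ℕ) :=
      (Module.finrank_eq_rank ℝ _).symm
    have h2 : Module.rank ℝ (Submodule.span ℝ (invProbCA p)) = Module.rank ℝ (invCA p) := by
      rw [span_invProbCA]
      exact (Submodule.equivMapOfInjective (FinAddMeasure.ca X).subtype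
        Subtype.val_injective (invCA p)).rank_eq.symm
    have h3 : invProbBA p = invProbCA p :=
      Set.Subset.antisymm (fun μ hμ => ⟨hstar hμ, hμ⟩) fun μ hμ => hμ.2
    exact ⟨_, h1, by rw [h3, h2, h1], h2.trans h1⟩
  · obtain ⟨E, hE, hAE, hEA, hEE, hrange⟩ := exists_mean_ergodic_projection (norm_markovCA_le p)
      (tendsto_cesaro_markovCA p hstar hσ hdom)
    obtain ⟨m, hm, hlt⟩ := exists_norm_mul_self_lt_one p hstar hdom hE hAE hEE
    obtain ⟨hspec, hlim⟩ :=
      isSpectralProjection_of_norm_lt_one (norm_markovCA_le p) hAE hEA hEE hm hlt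
    exact ⟨E, hspec, hrange, hlim⟩
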